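/- **Setting.** Let $1\le M\le N$. There are users $1,\dots,M$ and channels $1,\dots,N$. A *channel block* is given by integers $(c,s,q)$ with $1\le c\le\lfloor N/M\rfloor$; $0\le s\le\lfloor (N-cM)/(c-1)\rfloor$ if $c\ge 2$, and $s=0$ if $c=1$; and $0\le q\le N-L$, where $L=(c-1)(M+s)+M$. In this block the user with order $v\in\{1,\dots,M\}$ gets the $c$ equidistant channels $J_v(c,s,q)=\{\,q+k(M+s)+v : 0\le k<c\,\}$. An *interleaved allocation* consists of a channel block $(c,s,q)$, a permutation $\nu$ of $\{1,\dots,M\}$ ($\nu_i$ is the order of user $i$), and a power $p_i$ that user $i$ uses on each one of its channels. An instance of *Min-Power* is given by rate functions $f(i,j,p)$ (user $i$, channel $j$, power $p$), demands $d_i$, a user power limit $P^u$ and a channel power limit $P^s$. The allocation is feasible if, for every user $i$, $p_i$ lies in $A_i(J)=\{p\ge 0 : \sum_{j\in J}f(i,j,p)\ge d_i,\ cp\le P^u,\ p\le P^s\}$ with $J=J_{\nu_i}(c,s,q)$. The task is to find a feasible allocation with the least total power $\sum_{i}\sum_{j\in J_{\nu_i}(c,s,q)}p_i$ over all channel blocks,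 permutations and powers. The rate functions are arbitrary, except that each set $A_i(J_v(c,s,q))$ is assumed to be empty or to have a least element (as is the case if $f(i,j,\cdot)$ is continuous). The model of computation is a random access machine with cells for natural numbers and for reals. Additions, subtractions, comparisons and memory accesses cost one step each. The rates, demands and limits are accessed only through a routine that, given a user $i$ and a list of $n$ channels forming a set $J$, returns $\min\{p\ge 0:\sum_{j\in J}f(i,j,p)\ge d_i,\ |J|p\le P^u,\ p\le P^s\}$ or reports that there is no such minimum; a call costs $O(n)$ steps. **Theorem.** For all $1\le M\le N$ there are at most $(N+1)+(N+1)^3=O(N^3)$ channel blocks. Min-Power for interleaved channel allocation has a polynomial-time algorithm for global optimality: there are one program and one constant $C$ such that for all $1\le M\le N$ and every instance with $M$ users and $N$ channels, the program, started with input $(M,N)$, halts after at most $C\,M^3N^3$ steps and returns a globally optimal allocation $(c,s,q,\nu,p)$ with its total power, or reports infeasibility if there is no feasible allocation. -/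

import Mathlib

/-! ## Interleaved channel allocation and the Min-Power problem

Users are `0, …, M - 1` and channels are `0, …, N - 1`. -/

namespace IFDMA

/-- Parameters of a channel block: `c` sub blocks of `M` consecutive channels each, `s` unused
channels between neighbouring sub blocks, and `q` unused channels before the first one. -/
structure Block where
  c : ℕ
  s : ℕ
  q : ℕ

/-- The number of channels from the first to the last channel of the block. -/
def Block.length (b : Block) (M : ℕ) : ℕ := (b.c - 1) * (M + b.s) + M

/-- The parameter ranges of the channel blocks for `M` users and `N` channels. If there is only
one sub block, then `s` is meaningless and is fixed to be `0`. -/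
def Block.IsValid (b : Block) (M N : ℕ) : Prop :=
  1 ≤ b.c ∧ b.c ≤ N / M ∧
  (b.c = 1 → b.s = 0) ∧
  (2 ≤ b.c → b.s ≤ (N - b.c * M) / (b.c - 1)) ∧
  b.q ≤ N - b.length M

/-- The channels of the user that has order `v` in every sub block. -/
def Block.channels (b : Block) (M N : ℕ) (v : Fin M) : Finset (Fin N) :=
  {j : Fin N | ∃ k < b.c, (j : ℕ) = b.q + k * (M + b.s) + v}

/-- An instance of Min-Power. `rate i j p` is the rate of user `i` on channel `j` with power `p`. -/
structure Instance (M N : ℕ) where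
  rate : Fin M → Fin N → ℝ → ℝ
  demand : Fin M → ℝ
  userLimit : ℝ
  channelLimit : ℝ

namespace Instance

variable {M N : ℕ}

/-- The powers `p` such that user `i`, using power `p` on each channel of `J`, meets its demand
and respects both power limits. -/
def admissible (I : Instance M N) (i : Fin M) (J : Finset (Fin N)) : Set ℝ :=
  {p | 0 ≤ p ∧ I.demand i ≤ ∑ j ∈ J, I.rate i j p ∧
    (J.card : ℝ) * p ≤ I.userLimit ∧ p ≤ I.channelLimit}

/-- The minimum power of a user is well defined wherever the demand of the user can be met. -/
def HasMinima (I : Instance M N) : Prop :=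
  ∀ b : Block, b.IsValid M N → ∀ i v : Fin M,
    (I.admissible i (b.channels M N v)).Nonempty →
      ∃ p, IsLeast (I.admissible i (b.channels M N v)) p

end Instance

/-- A channel block, the order of each user in every sub block, and the power that each user has
on each one of its channels. -/
structure Allocation (M : ℕ) where
  block : Block
  order : Equiv.Perm (Fin M)
  power : Fin M → ℝ

/-- The total power: the sum over all users and over all channels of the user. -/
def Allocation.totalPower {M : ℕ} (a : Allocation M) (N : ℕ) : ℝ :=
  ∑ i : Fin M, ∑ _j ∈ a.block.channels M N (a.order i), a.power i

namespace Instance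

variable {M N : ℕ}

def IsFeasible (I : Instance M N) (a : Allocation M) : Prop :=
  a.block.IsValid M N ∧
  ∀ i : Fin M, a.power i ∈ I.admissible i (a.block.channels M N (a.order i))

/-- Global optimality, over all channel blocks, all orders of the users and all powers. -/
def IsOptimal (I : Instance M N) (a : Allocation M) : Prop :=
  I.IsFeasible a ∧ ∀ a' : Allocation M, I.IsFeasible a' → a.totalPower N ≤ a'.totalPower N

open Classical in
/-- The least power with which user `i` meets its demand on the channels in `S` within the power
limits, or `none` if there is no such power. -/
noncomputable def minPower (I : Instance M N) (i : ℕ) (S : Finset ℕ) : Option ℝ :=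
  if h : ∃ (hi : i < M) (p : ℝ),
      IsLeast (I.admissible ⟨i, hi⟩ {j : Fin N | (j : ℕ) ∈ S}) p
  then some h.choose_spec.choose else none

end Instance

end IFDMA

/-! ## Random access machine programs

The memory consists of arrays of natural numbers and arrays of reals; a program names finitely many
of them, and cells are addressed by computed indices. The only operations are addition, subtraction
and comparison (there is no multiplication, no rounding of reals, and no real constant but `0`), and
calls of the routine that finds the minimum power of one user on one list of channels. -/

namespace RAM

/-- `nat a k` and `real a k` are the cells `k` of the arrays `a`. -/
structure State where
  nat : ℕ → ℕ → ℕ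
  real : ℕ → ℕ → ℝ

/-- Write into one cell of an array. -/
def write {α : Type} (m : ℕ → ℕ → α) (a k : ℕ) (x : α) : ℕ → ℕ → α :=
  Function.update m a (Function.update (m a) k x)

/-- Expressions with values in the natural numbers; `sub` is truncated. -/
inductive NatExp where
  | const (n : ℕ)
  | read (a : ℕ) (k : NatExp)
  | add (x y : NatExp)
  | sub (x y : NatExp)

def NatExp.eval (σ : State) : NatExp → ℕ
  | const n => n
  | read a k => σ.nat a (k.eval σ)
  | add x y => x.eval σ + y.eval σ
  | sub x y => x.eval σ - y.eval σ

/-- The cost of an evaluation is the size of the expression. -/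
def NatExp.cost : NatExp → ℕ
  | const _ => 1
  | read _ k => k.cost + 1
  | add x y => x.cost + y.cost + 1
  | sub x y => x.cost + y.cost + 1

inductive RealExp where
  | zero
  | read (a : ℕ) (k : NatExp)
  | add (x y : RealExp)
  | sub (x y : RealExp)

noncomputable def RealExp.eval (σ : State) : RealExp → ℝ
  | zero => 0
  | read a k => σ.real a (k.eval σ)
  | add x y => x.eval σ + y.eval σ
  | sub x y => x.eval σ - y.eval σ

def RealExp.cost : RealExp → ℕ
  | zero => 1
  | read _ k => k.cost + 1
  | add x y => x.cost + y.cost + 1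
  | sub x y => x.cost + y.cost + 1

inductive Test where
  | natLe (x y : NatExp)
  | realLe (x y : RealExp)
  | neg (b : Test)
  | conj (b b' : Test)

def Test.Holds (σ : State) : Test → Prop
  | natLe x y => x.eval σ ≤ y.eval σ
  | realLe x y => x.eval σ ≤ y.eval σ
  | neg b => ¬ b.Holds σ
  | conj b b' => b.Holds σ ∧ b'.Holds σ

def Test.cost : Test → ℕ
  | natLe x y => x.cost + y.cost + 1
  | realLe x y => x.cost + y.cost + 1
  | neg b => b.cost + 1
  | conj b b' => b.cost + b'.cost + 1

inductive Program where
  | skip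
  /-- Write the value of `x` into the cell `k` of the array `a` of natural numbers. -/
  | setNat (a : ℕ) (k x : NatExp)
  /-- Write the value of `x` into the cell `k` of the array `a` of reals. -/
  | setReal (a : ℕ) (k : NatExp) (x : RealExp)
  | seq (P Q : Program)
  | branch (b : Test) (P Q : Program)
  | loop (b : Test) (P : Program)
  /-- Find the minimum power of user `i` on the channels that are listed in the first `n` cells of
  the array `a`. Whether there is one (`1` or `0`) is written into the cell `0` of the array `r` of
  natural numbers, and the power (or `0`) into the cell `0` of the array `r` of reals. -/
  | call (i : NatExp) (a : ℕ) (n : NatExp) (r : ℕ)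

/-- The channels listed in the first `n` cells of the array `a`. -/
def State.listed (σ : State) (a n : ℕ) : Finset ℕ := (Finset.range n).image (σ.nat a)

/-- The memory after a call with the given answer. -/
noncomputable def State.answer (σ : State) (r : ℕ) (o : Option ℝ) : State :=
  ⟨write σ.nat r 0 (if o.isSome then 1 else 0), write σ.real r 0 (o.getD 0)⟩

/-- `Exec O P σ τ t`: the program `P`, started in the state `σ`, halts in the state `τ` after `t`
steps, where calls are answered by `O`. Each command and each node of an expression costs one step;
a call costs one more step for each channel of the list. -/
inductive Exec (O : ℕ → Finset ℕ → Option ℝ) : Program → State → State → ℕ → Prop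
  | skip (σ : State) : Exec O .skip σ σ 1
  | setNat (σ : State) (a : ℕ) (k x : NatExp) :
      Exec O (.setNat a k x) σ ⟨write σ.nat a (k.eval σ) (x.eval σ), σ.real⟩
        (k.cost + x.cost + 1)
  | setReal (σ : State) (a : ℕ) (k : NatExp) (x : RealExp) :
      Exec O (.setReal a k x) σ ⟨σ.nat, write σ.real a (k.eval σ) (x.eval σ)⟩
        (k.cost + x.cost + 1)
  | seq {P Q : Program} {σ σ' τ : State} {t t' : ℕ} :
      Exec O P σ σ' t → Exec O Q σ' τ t' → Exec O (.seq P Q) σ τ (t + t' + 1)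
  | branchTrue {b : Test} {P Q : Program} {σ τ : State} {t : ℕ} :
      b.Holds σ → Exec O P σ τ t → Exec O (.branch b P Q) σ τ (b.cost + t + 1)
  | branchFalse {b : Test} {P Q : Program} {σ τ : State} {t : ℕ} :
      ¬ b.Holds σ → Exec O Q σ τ t → Exec O (.branch b P Q) σ τ (b.cost + t + 1)
  | loopStop {b : Test} {P : Program} {σ : State} :
      ¬ b.Holds σ → Exec O (.loop b P) σ σ (b.cost + 1)
  | loopStep {b : Test} {P : Program} {σ σ' τ : State} {t t' : ℕ} :
      b.Holds σ → Exec O P σ σ' t → Exec O (.loop b P) σ' τ t' →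
      Exec O (.loop b P) σ τ (b.cost + t + t' + 1)
  | call (σ : State) (i : NatExp) (a : ℕ) (n : NatExp) (r : ℕ) :
      Exec O (.call i a n r) σ (σ.answer r (O (i.eval σ) (σ.listed a (n.eval σ))))
        (i.cost + n.cost + n.eval σ + 1)

/-- The input: `M` and `N` in the cells `0` and `1` of the array `0`, all other cells `0`. -/
def State.init (M N : ℕ) : State :=
  ⟨write (write (fun _ _ => 0) 0 0 M) 0 1 N, fun _ _ => 0⟩

/-- The final memory says that there is no feasible allocation. -/
def State.ReportsInfeasible (σ : State) : Prop := σ.nat 1 0 = 0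

/-- The final memory holds the allocation `a` and its total power. -/
def State.Returns (σ : State) {M : ℕ} (a : IFDMA.Allocation M) (N : ℕ) : Prop :=
  σ.nat 1 0 = 1 ∧ σ.nat 1 1 = a.block.c ∧ σ.nat 1 2 = a.block.s ∧ σ.nat 1 3 = a.block.q ∧
  (∀ i : Fin M, σ.nat 2 i = a.order i) ∧
  (∀ i : Fin M, σ.real 0 i = a.power i) ∧
  σ.real 1 0 = a.totalPower N

end RAM

/-!
For a fixed block, the choice of `ν` and `p` is an assignment problem between users and orders whose
costs are the least powers. The Hungarian method solves it in `O(M⁴)` steps: each of the `M` rows is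
inserted by a search of at most `M` extensions, and each extension scans the `M²` entries. Every
visited row keeps a matching of its own, in which the alternating path to it is already switched, so
that no path has to be traced back.

For each of the at most `N / M` values of `c` there are `O(N)` offsets `q` and `O(N / c)` gaps `s`.
Per value of `c`, the `M²` calls of the routine with `c` channels for each block therefore cost
`O(M² N²)` steps in total, and the assignment problems `O(M⁴ N²)`; the sum over `c` is `O(M³ N³)`.
-/

namespace Hungarian

section

variable {ι κ G : Type*} [AddCommGroup G]

/-- The reduced cost of an entry of a cost matrix `W`, for potentials `U` of the rows and `V` of the
columns. -/
def slack (W : ι → κ → G) (U : ι → G) (V : κ → G) (i : ι) (j : κ) : G := W i j - U i - V j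

/-- The admissible entries of reduced cost `0`. -/
def Tight (F : ι → κ → Prop) (W : ι → κ → G) (U : ι → G) (V : κ → G) (i : ι) (j : κ) : Prop :=
  F i j ∧ slack W U V i j = 0

/-- Feasibility of the potentials for the dual of the assignment problem: no admissible entry has a
negative reduced cost. -/
def IsDual [LE G] (F : ι → κ → Prop) (W : ι → κ → G) (U : ι → G) (V : κ → G) : Prop :=
  ∀ i j, F i j → 0 ≤ slack W U V i j

/-- A matching that covers the rows in `S` by admissible entries. -/
structure IsMatching (F : ι → κ → Prop) (S : Set ι) (μ : ι → κ) : Prop where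
  edge : ∀ i ∈ S, F i (μ i)
  injOn : S.InjOn μ

/-- The admissible entries in visited rows and unvisited columns. -/
def frontier (F : ι → κ → Prop) (R : Set ι) (C : Set κ) : Set (ι × κ) :=
  {e | e.1 ∈ R ∧ e.2 ∉ C ∧ F e.1 e.2}

/-- The search for an augmenting path that starts in the row `root` has visited the rows in `R` and
the columns in `C`. Instead of the alternating path from `root` to a visited row `r`, it keeps the
matching `A r` that results from switching the edges along this path: it covers all rows in `S`
except `r`. -/
structure Search [LE G] (F : ι → κ → Prop) (W : ι → κ → G) (U : ι → G) (V : κ → G) (S : Set ι)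
    (root : ι) (R : Set ι) (C : Set κ) (A : ι → ι → κ) : Prop where
  dual : IsDual F W U V
  subset : R ⊆ S
  root_mem : root ∈ R
  matching : ∀ r ∈ R, IsMatching (Tight F W U V) (S \ {r}) (A r)
  col_iff : ∀ r ∈ R, ∀ i ∈ S \ {r}, (A r i ∈ C ↔ i ∈ R)
  unvisited : ∀ r ∈ R, ∀ i ∈ S \ R, A r i = A root i
  cols_subset : C ⊆ A root '' (R \ {root})

end

section Matching

variable {ι κ : Type*} {F F' : ι → κ → Prop} {S S' : Set ι} {μ ν : ι → κ}

theorem IsMatching.mono (h : IsMatching F S μ) (hS : S' ⊆ S)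
    (hF : ∀ i ∈ S', F i (μ i) → F' i (μ i)) : IsMatching F' S' μ :=
  ⟨fun i hi => hF i hi (h.edge i (hS hi)), h.injOn.mono hS⟩

theorem IsMatching.congr (h : IsMatching F S μ) (hν : S.EqOn ν μ) : IsMatching F S ν :=
  ⟨fun i hi => hν hi ▸ h.edge i hi, hν.injOn_iff.2 h.injOn⟩

theorem IsMatching.update [DecidableEq ι] {r : ι} {j : κ} (h : IsMatching F (S \ {r}) μ)
    (hrj : F r j) (hj : ∀ i ∈ S \ {r}, μ i ≠ j) : IsMatching F S (Function.update μ r j) where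
  edge i hi := by
    obtain rfl | hir := eq_or_ne i r
    · simpa using hrj
    · simpa [hir] using h.edge i ⟨hi, hir⟩
  injOn i hi k hk hik := by
    obtain rfl | hir := eq_or_ne i r <;> obtain rfl | hkr := eq_or_ne k i
    · rfl
    · simp only [Function.update_self, Function.update_of_ne hkr] at hik
      exact absurd hik.symm (hj k ⟨hk, hkr⟩)
    · rfl
    · obtain rfl | hkr' := eq_or_ne k r
      · simp only [Function.update_self, Function.update_of_ne hir] at hik
        exact absurd hik (hj i ⟨hi, hir⟩)
      · simp only [Function.update_of_ne hir, Function.update_of_ne hkr'] at hik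
        exact h.injOn ⟨hi, hir⟩ ⟨hk, hkr'⟩ hik

end Matching

section Search

variable {ι κ G : Type*} [AddCommGroup G] {F : ι → κ → Prop} {W : ι → κ → G} {U : ι → G} {V : κ → G}
  {S R : Set ι} {C : Set κ} {A A' : ι → ι → κ} {root r own : ι} {j : κ} {δ : G}

theorem Search.start [LE G] (hd : IsDual F W U V) (hroot : root ∈ S)
    (h : IsMatching (Tight F W U V) (S \ {root}) (A root)) :
    Search F W U V S root {root} ∅ A where
  dual := hd
  subset := Set.singleton_subset_iff.2 hroot
  root_mem := rfl
  matching := by rintro r rfl; exact h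
  col_iff := by rintro r rfl i ⟨-, hir⟩; simpa using hir
  unvisited := by rintro r rfl i -; rfl
  cols_subset := Set.empty_subset _

theorem Search.congr [LE G] (h : Search F W U V S root R C A)
    (hA : ∀ r ∈ R, S.EqOn (A' r) (A r)) : Search F W U V S root R C A' where
  dual := h.dual
  subset := h.subset
  root_mem := h.root_mem
  matching r hr := (h.matching r hr).congr ((hA r hr).mono Set.sdiff_subset)
  col_iff r hr i hi := by rw [hA r hr hi.1]; exact h.col_iff r hr i hi
  unvisited r hr i hi := by
    rw [hA r hr hi.1, hA root h.root_mem hi.1]; exact h.unvisited r hr i hi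
  cols_subset j hj := by
    obtain ⟨i, hi, rfl⟩ := h.cols_subset hj
    exact ⟨i, hi, hA root h.root_mem (h.subset hi.1)⟩

-- The visited rows violate Hall's condition: all their edges lead to `C`, which has fewer elements.
theorem Search.not_isMatching [LE G] (h : Search F W U V S root R C A) (hR : R.Finite)
    (hF : frontier F R C = ∅) (ν : ι → κ) : ¬ IsMatching F S ν := by
  intro hν
  have himage : ν '' R ⊆ A root '' (R \ {root}) := by
    rintro _ ⟨i, hi, rfl⟩
    refine h.cols_subset (by_contra fun hc => ?_)
    exact Set.eq_empty_iff_forall_notMem.1 hF (i, ν i) ⟨hi, hc, hν.edge i (h.subset hi)⟩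
  have hle : R.ncard ≤ (R \ {root}).ncard := calc
    R.ncard = (ν '' R).ncard := (hν.injOn.mono h.subset).ncard_image.symm
    _ ≤ (A root '' (R \ {root})).ncard := Set.ncard_le_ncard himage (hR.sdiff.image _)
    _ ≤ (R \ {root}).ncard := Set.ncard_image_le hR.sdiff
  exact hle.not_gt (Set.ncard_sdiff_singleton_lt_of_mem h.root_mem hR)

theorem Search.notMem_of_match [LE G] (h : Search F W U V S root R C A)
    (hown : own ∈ S \ {root}) (hC : A root own ∉ C) : own ∉ R :=
  fun hR => hC ((h.col_iff root h.root_mem own hown).2 hR)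

theorem Search.ne_of_ne [LE G] (h : Search F W U V S root R C A) (hown : own ∈ S \ {root})
    (hC : A root own ∉ C) {i : ι} (hr : r ∈ R) (hi : i ∈ S \ {r}) (hio : i ≠ own) :
    A r i ≠ A root own := by
  have hR := h.notMem_of_match hown hC
  rw [← h.unvisited r hr own ⟨hown.1, hR⟩]
  exact fun he => hio ((h.matching r hr).injOn hi ⟨hown.1, fun ho => hR (ho ▸ hr)⟩ he)

theorem Search.visit [LE G] [DecidableEq ι] (h : Search F W U V S root R C A)
    (hrj : (r, j) ∈ frontier (Tight F W U V) R C) (hown : own ∈ S \ {root})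
    (hj : A root own = j) :
    Search F W U V S root (insert own R) (insert j C)
      (Function.update A own (Function.update (A r) r j)) := by
  subst hj
  obtain ⟨hr, hC, ht⟩ := hrj
  have hR := h.notMem_of_match hown hC
  have hne : ∀ i ∈ R, i ≠ own := fun i hi ho => hR (ho ▸ hi)
  have hold : ∀ i ∈ R, Function.update A own (Function.update (A r) r (A root own)) i = A i :=
    fun i hi => Function.update_of_ne (hne i hi) _ _
  refine ⟨h.dual, Set.insert_subset hown.1 h.subset, Or.inr h.root_mem, ?_, ?_, ?_, ?_⟩
  · rintro i (rfl | hi)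
    · rw [Function.update_self]
      exact ((h.matching r hr).mono (Set.sdiff_subset_sdiff_left Set.sdiff_subset)
        fun _ _ => id).update ht fun k hk => h.ne_of_ne hown hC hr ⟨hk.1.1, hk.2⟩ hk.1.2
    · rw [hold i hi]
      exact h.matching i hi
  · rintro i (rfl | hi) k hk
    · obtain rfl | hkr := eq_or_ne k r
      · simp [hr]
      · simp [hkr, h.col_iff r hr k ⟨hk.1, hkr⟩, h.ne_of_ne hown hC hr ⟨hk.1, hkr⟩ hk.2,
          show k ≠ i from hk.2]
    · obtain rfl | hko := eq_or_ne k own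
      · simp [hold i hi, h.unvisited i hi k ⟨hk.1, hR⟩]
      · simp [hold i hi, h.col_iff i hi k hk, h.ne_of_ne hown hC hi hk hko, hko]
  · rintro i hi k ⟨hkS, hk⟩
    rw [Set.mem_insert_iff, not_or] at hk
    rw [hold root h.root_mem]
    rcases hi with rfl | hi
    · rw [Function.update_self, Function.update_of_ne (ne_of_mem_of_not_mem hr hk.2).symm]
      exact h.unvisited r hr k ⟨hkS, hk.2⟩
    · rw [hold i hi, h.unvisited i hi k ⟨hkS, hk.2⟩]
  · rw [hold root h.root_mem]
    rintro k (rfl | hk)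
    · exact ⟨own, ⟨Or.inl rfl, hown.2⟩, rfl⟩
    · exact Set.image_mono (Set.sdiff_subset_sdiff_left (Set.subset_insert _ _)) (h.cols_subset hk)

theorem Search.augment [LE G] [DecidableEq ι] (h : Search F W U V S root R C A)
    (hrj : (r, j) ∈ frontier (Tight F W U V) R C) (hfree : ∀ i ∈ S \ {root}, A root i ≠ j) :
    IsMatching (Tight F W U V) S (Function.update (A r) r j) := by
  obtain ⟨hr, hC, ht⟩ := hrj
  refine (h.matching r hr).update ht fun i hi hij => ?_
  by_cases hiR : i ∈ R
  · exact hC (hij ▸ (h.col_iff r hr i hi).2 hiR)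
  · exact hfree i ⟨hi.1, fun he => hiR (he ▸ h.root_mem)⟩ (h.unvisited r hr i ⟨hi.1, hiR⟩ ▸ hij)

theorem slack_shift (i : ι) :
    slack W (U + R.indicator fun _ => δ) (V - C.indicator fun _ => δ) i j =
      slack W U V i j - R.indicator (fun _ => δ) i + C.indicator (fun _ => δ) j := by
  simp only [slack, Pi.add_apply, Pi.sub_apply]
  abel

theorem frontier_shift {e : ι × κ} (he : e ∈ frontier F R C) (hδ : slack W U V e.1 e.2 = δ) :
    e ∈ frontier (Tight F W (U + R.indicator fun _ => δ) (V - C.indicator fun _ => δ)) R C := by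
  obtain ⟨hR, hC, hF⟩ := he
  exact ⟨hR, hC, hF, by simp [slack_shift, hR, hC, hδ]⟩

variable [LinearOrder G] [IsOrderedAddMonoid G]

theorem IsDual.shift (h : IsDual F W U V) (hδ : 0 ≤ δ)
    (hmin : ∀ e ∈ frontier F R C, δ ≤ slack W U V e.1 e.2) :
    IsDual F W (U + R.indicator fun _ => δ) (V - C.indicator fun _ => δ) := by
  intro i j hF
  rw [slack_shift]
  have h0 := h i j hF
  by_cases hi : i ∈ R <;> by_cases hj : j ∈ C
  · simpa [hi, hj] using h0
  · simpa [hi, hj] using hmin (i, j) ⟨hi, hj, hF⟩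
  · simpa [hi, hj] using add_nonneg h0 hδ
  · simpa [hi, hj] using h0

theorem Search.shift (h : Search F W U V S root R C A) (hδ : 0 ≤ δ)
    (hmin : ∀ e ∈ frontier F R C, δ ≤ slack W U V e.1 e.2) :
    Search F W (U + R.indicator fun _ => δ) (V - C.indicator fun _ => δ) S root R C A :=
  { h with
    dual := h.dual.shift hδ hmin
    matching := fun r hr => (h.matching r hr).mono subset_rfl fun i hi ⟨hF, ht⟩ => by
      refine ⟨hF, ?_⟩
      have := h.col_iff r hr i hi
      by_cases hiR : i ∈ R
      · simp [slack_shift, hiR, this.2 hiR, ht]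
      · simp [slack_shift, hiR, this.not.2 hiR, ht] }

theorem IsMatching.sum_le {S : Finset ι} {T : Finset κ} {μ ν : ι → κ}
    (hμ : IsMatching (Tight F W U V) S μ) (hd : IsDual F W U V) (hν : IsMatching F S ν)
    (hT : ∀ i j, F i j → j ∈ T) (hcard : T.card ≤ S.card) :
    ∑ i ∈ S, W i (μ i) ≤ ∑ i ∈ S, W i (ν i) := by
  have hsum : ∀ ρ : ι → κ, IsMatching F S ρ → ∑ i ∈ S, V (ρ i) = ∑ j ∈ T, V j := fun ρ hρ =>
    Finset.sum_nbij ρ (fun i hi => hT i _ (hρ.edge i hi)) hρ.injOn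
      (Finset.surjOn_of_injOn_of_card_le ρ (fun i hi => hT i _ (hρ.edge i hi)) hρ.injOn hcard)
      fun _ _ => rfl
  have hμ' : IsMatching F S μ := hμ.mono subset_rfl fun _ _ => And.left
  calc ∑ i ∈ S, W i (μ i) = ∑ i ∈ S, (U i + V (μ i)) := Finset.sum_congr rfl fun i hi => by
        simpa [slack, sub_sub, sub_eq_zero] using (hμ.edge i hi).2
    _ = ∑ i ∈ S, (U i + V (ν i)) := by
        rw [Finset.sum_add_distrib, Finset.sum_add_distrib, hsum μ hμ', hsum ν hν]
    _ ≤ ∑ i ∈ S, W i (ν i) := Finset.sum_le_sum fun i hi => by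
        simpa [slack, sub_sub, sub_nonneg] using hd i _ (hν.edge i hi)

end Search

end Hungarian

namespace RAM

/-- `P`, started in `σ`, halts after at most `T` steps in a state that satisfies `R`. -/
def Runs (O : ℕ → Finset ℕ → Option ℝ) (P : Program) (σ : State) (T : ℕ) (R : State → Prop) :
    Prop :=
  ∃ τ t, Exec O P σ τ t ∧ t ≤ T ∧ R τ

/-- The arrays of natural numbers that a program may write to. -/
def Program.natTargets : Program → List ℕ
  | .skip => []
  | .setNat a _ _ => [a]
  | .setReal _ _ _ => []
  | .seq P Q => P.natTargets ++ Q.natTargets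
  | .branch _ P Q => P.natTargets ++ Q.natTargets
  | .loop _ P => P.natTargets
  | .call _ _ _ r => [r]

/-- The arrays of reals that a program may write to. -/
def Program.realTargets : Program → List ℕ
  | .skip => []
  | .setNat _ _ _ => []
  | .setReal a _ _ => [a]
  | .seq P Q => P.realTargets ++ Q.realTargets
  | .branch _ P Q => P.realTargets ++ Q.realTargets
  | .loop _ P => P.realTargets
  | .call _ _ _ r => [r]

/-- The frame condition of a run of `P` from `σ` to `τ`: arrays that are not targets of `P` are
unchanged. -/
structure Agree (P : Program) (σ τ : State) : Prop where
  nat : ∀ a ∉ P.natTargets, τ.nat a = σ.nat a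
  real : ∀ a ∉ P.realTargets, τ.real a = σ.real a

theorem write_self {α : Type} (m : ℕ → ℕ → α) (a k : ℕ) (x : α) :
    write m a k x a = Function.update (m a) k x := by
  simp [write]

theorem write_of_ne {α : Type} (m : ℕ → ℕ → α) {a a' : ℕ} (k : ℕ) (x : α) (h : a' ≠ a) :
    write m a k x a' = m a' := by
  simp [write, h]

attribute [simp] write_self write_of_ne NatExp.eval NatExp.cost RealExp.eval RealExp.cost
  Test.Holds Test.cost Program.natTargets Program.realTargets

section Frame

variable {O : ℕ → Finset ℕ → Option ℝ} {P Q : Program} {σ σ' τ : State}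

theorem Agree.refl (P : Program) (σ : State) : Agree P σ σ := ⟨fun _ _ => rfl, fun _ _ => rfl⟩

theorem Agree.trans (h : Agree P σ σ') (h' : Agree P σ' τ) : Agree P σ τ :=
  ⟨fun a ha => (h'.nat a ha).trans (h.nat a ha), fun a ha => (h'.real a ha).trans (h.real a ha)⟩

theorem Agree.of_subset (h : Agree P σ τ) (hn : P.natTargets ⊆ Q.natTargets)
    (hr : P.realTargets ⊆ Q.realTargets) : Agree Q σ τ :=
  ⟨fun a ha => h.nat a fun h' => ha (hn h'), fun a ha => h.real a fun h' => ha (hr h')⟩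

theorem Exec.agree {t : ℕ} (h : Exec O P σ τ t) : Agree P σ τ := by
  induction h with
  | skip | loopStop => exact .refl _ _
  | setNat | setReal | call =>
    constructor <;> intro b hb <;> simp_all [State.answer]
  | seq _ _ ih ih' =>
    exact (ih.of_subset (by simp) (by simp)).trans (ih'.of_subset (by simp) (by simp))
  | branchTrue _ _ ih | branchFalse _ _ ih => exact ih.of_subset (by simp) (by simp)
  | loopStep _ _ _ ih ih' => exact Agree.trans ⟨ih.nat, ih.real⟩ ih'

end Frame

section Rules

variable {O : ℕ → Finset ℕ → Option ℝ} {P Q : Program} {b : Test} {σ : State} {T T' T'' : ℕ}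
  {R R' : State → Prop}

theorem Runs.mono (h : Runs O P σ T R) (hT : T ≤ T') (hR : ∀ τ, Agree P σ τ → R τ → R' τ) :
    Runs O P σ T' R' := by
  obtain ⟨τ, t, he, ht, hτ⟩ := h
  exact ⟨τ, t, he, ht.trans hT, hR τ he.agree hτ⟩

theorem Runs.seq (h : Runs O P σ T R) (h' : ∀ σ', Agree P σ σ' → R σ' → Runs O Q σ' T' R')
    (hT : T + T' + 1 ≤ T'') : Runs O (.seq P Q) σ T'' R' := by
  obtain ⟨σ', t, he, ht, hσ'⟩ := h
  obtain ⟨τ, t', he', ht', hτ⟩ := h' σ' he.agree hσ'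
  exact ⟨τ, _, .seq he he', by lia, hτ⟩

theorem Runs.branch (hP : b.Holds σ → Runs O P σ T R) (hQ : ¬ b.Holds σ → Runs O Q σ T R) :
    Runs O (.branch b P Q) σ (b.cost + T + 1) R := by
  by_cases hb : b.Holds σ
  · obtain ⟨τ, t, he, ht, hτ⟩ := hP hb
    exact ⟨τ, _, .branchTrue hb he, by lia, hτ⟩
  · obtain ⟨τ, t, he, ht, hτ⟩ := hQ hb
    exact ⟨τ, _, .branchFalse hb he, by lia, hτ⟩

theorem Runs.call (i : NatExp) (a : ℕ) (n : NatExp) (r : ℕ) (σ : State) :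
    Runs O (.call i a n r) σ (i.cost + n.cost + n.eval σ + 1)
      (· = σ.answer r (O (i.eval σ) (σ.listed a (n.eval σ)))) :=
  ⟨_, _, .call σ i a n r, le_rfl, rfl⟩

theorem Runs.loop (Inv : State → Prop) (m : State → ℕ) (h0 : Inv σ)
    (hstep : ∀ σ', Agree P σ σ' → Inv σ' → b.Holds σ' →
      Runs O P σ' T fun τ => Inv τ ∧ (b.Holds τ → m τ < m σ')) :
    Runs O (.loop b P) σ ((m σ + 2) * (T + b.cost + 1)) fun τ => Inv τ ∧ ¬ b.Holds τ := by
  suffices H : ∀ n σ', (b.Holds σ' → m σ' < n) → Agree P σ σ' → Inv σ' →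
      Runs O (.loop b P) σ' ((n + 1) * (T + b.cost + 1)) fun τ => Inv τ ∧ ¬ b.Holds τ from
    H (m σ + 1) σ (fun _ => Nat.lt_succ_self _) (.refl _ _) h0
  intro n
  induction n with
  | zero =>
    exact fun σ' hn _ hi => ⟨σ', _, .loopStop fun hb => absurd (hn hb) (Nat.not_lt_zero _),
      by lia, hi, fun hb => absurd (hn hb) (Nat.not_lt_zero _)⟩
  | succ n ih =>
    intro σ' hn ha hi
    by_cases hb : b.Holds σ'
    · obtain ⟨σ₁, t₁, he₁, ht₁, hi₁, hm⟩ := hstep σ' ha hi hb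
      obtain ⟨τ, t, he, ht, hτ⟩ := ih σ₁ (fun hb₁ => by have := hm hb₁; have := hn hb; lia)
        (ha.trans he₁.agree) hi₁
      refine ⟨τ, _, .loopStep hb he₁ he, ?_, hτ⟩
      rw [Nat.succ_mul (n + 1)]
      lia
    · refine ⟨σ', _, .loopStop hb, ?_, hi, hb⟩
      rw [Nat.succ_mul (n + 1)]
      lia

/-- Programs without loops and calls. -/
def Program.IsLoopFree : Program → Bool
  | .skip | .setNat _ _ _ | .setReal _ _ _ => true
  | .seq P Q => P.IsLoopFree && Q.IsLoopFree
  | .branch _ P Q => P.IsLoopFree && Q.IsLoopFree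
  | .loop _ _ | .call _ _ _ _ => false

/-- The worst-case number of steps of a loop-free program; `0` is a dummy value for loops and
calls. -/
def Program.steps : Program → ℕ
  | .skip => 1
  | .setNat _ k x => k.cost + x.cost + 1
  | .setReal _ k x => k.cost + x.cost + 1
  | .seq P Q => P.steps + Q.steps + 1
  | .branch b P Q => b.cost + max P.steps Q.steps + 1
  | .loop _ _ | .call _ _ _ _ => 0

open Classical in
/-- The state after a loop-free program; loops and calls are ignored. -/
noncomputable def Program.effect : Program → State → State
  | .skip, σ => σ
  | .setNat a k x, σ => ⟨write σ.nat a (k.eval σ) (x.eval σ), σ.real⟩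
  | .setReal a k x, σ => ⟨σ.nat, write σ.real a (k.eval σ) (x.eval σ)⟩
  | .seq P Q, σ => Q.effect (P.effect σ)
  | .branch b P Q, σ => if b.Holds σ then P.effect σ else Q.effect σ
  | .loop _ _, σ | .call _ _ _ _, σ => σ

theorem runs_effect (σ : State) (h : P.IsLoopFree) : Runs O P σ P.steps (· = P.effect σ) := by
  induction P generalizing σ with
  | skip => exact ⟨_, _, .skip σ, le_rfl, rfl⟩
  | setNat a k x => exact ⟨_, _, .setNat σ a k x, le_rfl, rfl⟩
  | setReal a k x => exact ⟨_, _, .setReal σ a k x, le_rfl, rfl⟩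
  | seq P Q ihP ihQ =>
    rw [Program.IsLoopFree, Bool.and_eq_true] at h
    exact (ihP σ h.1).seq (fun _ _ hσ' => hσ' ▸ ihQ _ h.2) le_rfl
  | branch b P Q ihP ihQ =>
    rw [Program.IsLoopFree, Bool.and_eq_true] at h
    refine .branch (fun hb => (ihP σ h.1).mono (le_max_left _ _) fun τ _ hτ => ?_)
      fun hb => (ihQ σ h.2).mono (le_max_right _ _) fun τ _ hτ => ?_
    · simp [Program.effect, hb, hτ]
    · simp [Program.effect, hb, hτ]
  | loop | call => cases h

theorem Runs.of_effect (h : P.IsLoopFree) (hT : P.steps ≤ T) (hR : R (P.effect σ)) :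
    Runs O P σ T R :=
  (runs_effect σ h).mono hT fun _ _ hτ => hτ ▸ hR

end Rules

end RAM

namespace RAM

/-- The value of the cell `0` of an array; such an array serves as a register. -/
abbrev NatExp.get (a : ℕ) : NatExp := .read a (.const 0)

/-- The value of the cell `0` of an array of reals. -/
abbrev RealExp.get (a : ℕ) : RealExp := .read a (.const 0)

/-- Write into the cell `0` of an array of natural numbers. -/
abbrev Program.put (a : ℕ) (x : NatExp) : Program := .setNat a (.const 0) x

/-- Add `1` to the cell `0` of an array of natural numbers. -/
abbrev Program.increment (a : ℕ) : Program := .put a (.add (.get a) (.const 1))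

/-- The strict inequality of natural numbers. -/
abbrev Test.lt (x y : NatExp) : Test := .neg (.natLe y x)

/-- Flags are natural numbers; a positive one is set. -/
abbrev Test.isSet (x : NatExp) : Test := .natLe (.const 1) x

/-- The state after writing `v` into the cell `0` of an array of natural numbers. -/
abbrev State.put (σ : State) (a v : ℕ) : State := ⟨write σ.nat a 0 v, σ.real⟩

/-- Run `P` with the values `0, …, n - 1` in the cell `0` of the array `x`. -/
def Program.forLoop (x : ℕ) (n : NatExp) (P : Program) : Program :=
  .seq (.put x (.const 0)) (.loop (.lt (.get x) n) (.seq P (.increment x)))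

/-- Run `P` with all pairs of values `0, …, n - 1` in the cells `0` of the arrays `x` and `y`. -/
def Program.forGrid (x y : ℕ) (n : NatExp) (P : Program) : Program :=
  .forLoop x n (.forLoop y n P)

/-- Write the arithmetic progression `first, first + step, …, first + n * step` into the array
`a`. -/
def Program.progression (a x : ℕ) (first step n : NatExp) : Program :=
  .seq (.setNat a (.const 0) first)
    (.forLoop x n (.setNat a (.add (.get x) (.const 1)) (.add (.read a (.get x)) step)))

/-- Write the sum of the values of `e` for the values `0, …, n - 1` of the register `x` into the
cell `0` of the array `a`. -/
def Program.accumulate (a x : ℕ) (n : NatExp) (e : RealExp) : Program :=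
  .seq (.setReal a (.const 0) .zero)
    (.forLoop x n (.setReal a (.const 0) (.add (.get a) e)))

section Loops

variable {O : ℕ → Finset ℕ → Option ℝ} {σ : State} {x y a m T : ℕ} {n first step : NatExp}
  {P : Program}

theorem agree_forLoop_put (v : ℕ) : Agree (.forLoop x n P) σ (σ.put x v) :=
  ⟨fun _ ha => write_of_ne _ _ _ fun h => ha (by simp [Program.forLoop, h]), fun _ _ => rfl⟩

theorem Runs.forLoop (Inv : ℕ → State → Prop) (hx : x ∉ P.natTargets)
    (hn : ∀ σ', Agree (.forLoop x n P) σ σ' → n.eval σ' = m)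
    (hInv : ∀ k σ' v, Inv k σ' → Inv k (σ'.put x v)) (h0 : Inv 0 σ)
    (hstep : ∀ k < m, ∀ σ', Agree (.forLoop x n P) σ σ' → σ'.nat x 0 = k → Inv k σ' →
      Runs O P σ' T (Inv (k + 1))) :
    Runs O (.forLoop x n P) σ ((m + 3) * (T + n.cost + 12)) (Inv m) := by
  have hagree : ∀ {σ'}, Agree (.seq P (.increment x)) (σ.put x 0) σ' →
      Agree (.forLoop x n P) σ σ' := fun h =>
    (agree_forLoop_put 0).trans
      (h.of_subset (by simp [Program.forLoop]) (by simp [Program.forLoop]))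
  have hpass : ∀ σ', Agree (.seq P (.increment x)) (σ.put x 0) σ' →
      Inv (σ'.nat x 0) σ' ∧ σ'.nat x 0 ≤ m → (Test.lt (.get x) n).Holds σ' →
      Runs O (.seq P (.increment x)) σ' (T + 7) fun τ =>
        (Inv (τ.nat x 0) τ ∧ τ.nat x 0 ≤ m) ∧
        ((Test.lt (.get x) n).Holds τ → m - τ.nat x 0 < m - σ'.nat x 0) := by
    rintro σ' ha ⟨hi, -⟩ hb
    have hk : σ'.nat x 0 < m := by simpa [hn σ' (hagree ha)] using hb
    refine (hstep _ hk σ' (hagree ha) rfl hi).seq (T' := 6) (fun τ hτ hi' => ?_) le_rfl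
    have hx' : τ.nat x 0 = σ'.nat x 0 := congrFun (hτ.nat x hx) 0
    refine .of_effect rfl (by simp [Program.steps]) ?_
    simp only [Program.effect, NatExp.eval, hx', write_self, Function.update_self]
    exact ⟨⟨hInv _ _ _ hi', hk⟩, fun _ => by lia⟩
  refine (runs_effect σ rfl).seq (T' := (m + 2) * (T + n.cost + 12)) ?_
    (by simp [Program.steps]; lia)
  rintro _ - rfl
  refine (Runs.loop (fun σ' => Inv (σ'.nat x 0) σ' ∧ σ'.nat x 0 ≤ m) (fun σ' => m - σ'.nat x 0)
    (by simpa [Program.effect] using hInv 0 σ 0 h0) hpass).mono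
    (by simp; lia) ?_
  rintro τ ha ⟨⟨hi, hle⟩, hb⟩
  have hge : m ≤ τ.nat x 0 := by simpa [hn τ (hagree ⟨ha.nat, ha.real⟩)] using hb
  rwa [le_antisymm hle hge] at hi

theorem Runs.sweep {α : Type*} (arr : State → ℕ → α) (f : ℕ → α) (hx : x ∉ P.natTargets)
    (hn : ∀ σ', Agree (.forLoop x n P) σ σ' → n.eval σ' = m)
    (harr : ∀ σ' v, arr (σ'.put x v) = arr σ')
    (hstep : ∀ k < m, ∀ σ', Agree (.forLoop x n P) σ σ' → σ'.nat x 0 = k → arr σ' k = arr σ k →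
      Runs O P σ' T fun τ => arr τ = Function.update (arr σ') k (f k)) :
    Runs O (.forLoop x n P) σ ((m + 3) * (T + n.cost + 12)) fun τ =>
      arr τ = fun k => if k < m then f k else arr σ k := by
  refine .forLoop (fun k τ => arr τ = fun l => if l < k then f l else arr σ l) hx hn
    (fun k σ' v h => by rw [harr, h]) (by simp) fun k hk σ' ha hx' hσ' => ?_
  refine (hstep k hk σ' ha hx' (by simp [hσ'])).mono le_rfl fun τ _ hτ => ?_
  ext l
  obtain rfl | hl := eq_or_ne l k
  · simp [hτ]
  · simp [hτ, hσ', hl, Order.lt_add_one_iff, hl.le_iff_lt]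

theorem Runs.forGrid (Inv : Set (ℕ × ℕ) → State → Prop) (hxy : x ≠ y) (hx : x ∉ P.natTargets)
    (hy : y ∉ P.natTargets) (hn : ∀ σ', Agree (.forGrid x y n P) σ σ' → n.eval σ' = m)
    (hInv : ∀ S σ' v, Inv S σ' → Inv S (σ'.put x v) ∧ Inv S (σ'.put y v)) (h0 : Inv ∅ σ)
    (hstep : ∀ i < m, ∀ j < m, ∀ S σ', Agree (.forGrid x y n P) σ σ' → σ'.nat x 0 = i →
      σ'.nat y 0 = j → Inv S σ' → Runs O P σ' T (Inv (insert (i, j) S))) :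
    Runs O (.forGrid x y n P) σ ((m + 3) ^ 2 * (T + 2 * n.cost + 24))
      (Inv (Set.Iio m ×ˢ Set.Iio m)) := by
  refine (Runs.forLoop (m := m) (T := (m + 3) * (T + n.cost + 12))
    (fun i => Inv (Set.Iio i ×ˢ Set.Iio m))
    (by simp [Program.forLoop, hxy, hx]) hn (fun _ _ v h => (hInv _ _ v h).1)
    (by simpa using h0) fun i hi σ' ha hi' h => ?_).mono (by ring_nf; nlinarith) fun _ _ h => h
  have hagree : ∀ {τ}, Agree (.forLoop y n P) σ' τ → Agree (.forGrid x y n P) σ τ := fun h =>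
    ha.trans (h.of_subset (by simp [Program.forLoop, List.subset_def]; tauto)
      (by simp [Program.forLoop]))
  have hrow : ∀ j, insert (i, j) (Set.Iio i ×ˢ Set.Iio m ∪ {i} ×ˢ Set.Iio j) =
      Set.Iio i ×ˢ Set.Iio m ∪ {i} ×ˢ Set.Iio (j + 1) := fun j => by
    ext ⟨k, l⟩
    simp
    grind
  refine (Runs.forLoop (fun j => Inv (Set.Iio i ×ˢ Set.Iio m ∪ {i} ×ˢ Set.Iio j)) hy
    (fun τ h' => hn τ (hagree h')) (fun _ _ v h => (hInv _ _ v h).2) (by simpa using h)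
    fun j hj τ h' hj' hi'' => ?_).mono le_rfl fun τ _ h' => ?_
  · rw [← hrow]
    have hxy' : x ∉ (Program.forLoop y n P).natTargets := by simp [Program.forLoop, hxy, hx]
    exact hstep i hi j hj _ τ (hagree h') ((congrFun (h'.nat x hxy') 0).trans hi') hj' hi''
  · convert h' using 1
    ext ⟨k, l⟩
    simp
    grind

theorem Runs.progression (d : ℕ) (hax : a ≠ x)
    (hstep : ∀ σ', Agree (.progression a x first step n) σ σ' → step.eval σ' = d)
    (hn : ∀ σ', Agree (.progression a x first step n) σ σ' → n.eval σ' = m) :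
    Runs O (.progression a x first step n) σ
      ((m + 3) * (first.cost + step.cost + n.cost + 30))
      fun τ => ∀ l ≤ m, τ.nat a l = first.eval σ + l * d := by
  refine (runs_effect σ rfl).seq (T' := (m + 3) * (step.cost + 12 + n.cost + 12)) ?_ ?_
  · rintro σ₀ h₀ rfl
    have hagree : ∀ {σ'}, Agree (.forLoop x n
        (.setNat a (.add (.get x) (.const 1)) (.add (.read a (.get x)) step))) _ σ' →
        Agree (.progression a x first step n) σ σ' := fun h =>
      (h₀.of_subset (by simp [Program.progression]) (by simp)).trans
        (h.of_subset (by simp [Program.progression]) (by simp [Program.progression]))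
    refine .forLoop (fun k τ => ∀ l ≤ k, τ.nat a l = first.eval σ + l * d) (by simpa using hax.symm)
      (fun σ' h => hn σ' (hagree h)) (fun k σ' v h => by simpa [hax] using h)
      (fun l hl => by simp [Program.effect, Nat.le_zero.1 hl]) fun k _ σ' ha hk hi =>
        .of_effect rfl (by simp [Program.steps]; lia) ?_
    intro l hl
    simp only [Program.effect, NatExp.eval, write_self, hk, hi k le_rfl, hstep σ' (hagree ha)]
    obtain rfl | hlk := eq_or_ne l (k + 1)
    · simp; ring
    · simp [hlk, hi l (by lia)]
  · simp only [Program.steps, NatExp.cost]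
    nlinarith

theorem Runs.accumulate {e : RealExp} (f : ℕ → ℝ)
    (hn : ∀ σ', Agree (.accumulate a x n e) σ σ' → n.eval σ' = m)
    (he : ∀ i < m, ∀ σ', Agree (.accumulate a x n e) σ σ' → σ'.nat x 0 = i → e.eval σ' = f i) :
    Runs O (.accumulate a x n e) σ ((m + 3) * (e.cost + n.cost + 23)) fun τ =>
      τ.real a 0 = ∑ i ∈ Finset.range m, f i := by
  refine (runs_effect σ rfl).seq (T' := (m + 3) * (e.cost + 7 + n.cost + 12)) ?_ ?_
  · rintro σ₀ h₀ rfl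
    have hagree : ∀ {σ'}, Agree (.forLoop x n (.setReal a (.const 0) (.add (.get a) e))) _ σ' →
        Agree (.accumulate a x n e) σ σ' := fun h =>
      (h₀.of_subset (by simp) (by simp [Program.accumulate])).trans
        (h.of_subset (by simp [Program.accumulate]) (by simp [Program.accumulate]))
    refine .forLoop (fun k τ => τ.real a 0 = ∑ i ∈ Finset.range k, f i) (by simp)
      (fun σ' h => hn σ' (hagree h)) (fun _ _ _ h => h) (by simp [Program.effect])
      fun k hk σ' ha hx hi => .of_effect rfl (by simp [Program.steps]; lia) ?_
    simp [Program.effect, hi, he k hk σ' (hagree ha) hx, Finset.sum_range_succ]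
  · simp only [Program.steps, NatExp.cost, RealExp.cost]
    nlinarith

end Loops

end RAM

namespace RAM

-- Arrays of natural numbers and arrays of reals are numbered separately. A matrix is stored row by
-- row, and the array `rowStart` replaces the multiplication in the computation of the index.
namespace Reg

abbrev input := 0
abbrev output := 1
abbrev order := 2
abbrev count := 3
abbrev gap := 4
abbrev offset := 5
abbrev length := 6
abbrev base := 7
abbrev row := 8
abbrev col := 9
abbrev idx := 10
abbrev list := 11
abbrev answer := 12
abbrev flag := 13
abbrev rowStart := 14
abbrev cur := 15
abbrev rowSeen := 16
abbrev colSeen := 17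
abbrev matching := 18
abbrev found := 19
abbrev minRow := 20
abbrev minCol := 21
abbrev owner := 22

abbrev power := 0
abbrev total := 1
abbrev cost := 2
abbrev rowPot := 3
abbrev colPot := 4
abbrev delta := 5
abbrev sum := 6
abbrev objective := 7

end Reg

/-- The number `M` of users. -/
abbrev NatExp.users : NatExp := .get Reg.input

/-- The number `N` of channels. -/
abbrev NatExp.channels : NatExp := .read Reg.input (.const 1)

/-- The index of the cell of a matrix entry. -/
abbrev NatExp.entry (i j : NatExp) : NatExp := .add (.read Reg.rowStart i) j

/-- The column that is assigned to the current row. -/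
abbrev NatExp.assigned : NatExp := .read Reg.matching (.entry .users (.get Reg.row))

/-- The cost of the current row in the assignment. -/
abbrev RealExp.assignedCost : RealExp := .read Reg.cost (.entry (.get Reg.row) .assigned)

/-- The reduced cost of the current entry. -/
abbrev RealExp.slack : RealExp :=
  .sub (.sub (.read Reg.cost (.entry (.get Reg.row) (.get Reg.col)))
    (.read Reg.rowPot (.get Reg.row))) (.read Reg.colPot (.get Reg.col))

/-- The current entry is admissible, in a visited row and in an unvisited column. -/
abbrev Test.onFrontier : Test :=
  .conj (.isSet (.read Reg.rowSeen (.get Reg.row)))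
    (.conj (.neg (.isSet (.read Reg.colSeen (.get Reg.col))))
      (.isSet (.read Reg.flag (.entry (.get Reg.row) (.get Reg.col)))))

/-- The current block ends within the channels. -/
abbrev Test.fitsAtOffset : Test := .natLe (.add (.get Reg.offset) (.get Reg.length)) .channels

/-- There is a block with the current number of sub blocks and the current gap; a single sub block
has the gap `0`. -/
abbrev Test.hasBlock : Test :=
  .conj (.natLe (.get Reg.length) .channels)
    (.neg (.conj (.natLe (.get Reg.count) (.const 1)) (.isSet (.get Reg.gap))))

namespace Program

/-- Keep the current entry if it is on the frontier and better than the entry found so far. -/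
def scanEntry : Program :=
  .branch (.conj .onFrontier
      (.neg (.conj (.isSet (.get Reg.found)) (.realLe (.get Reg.delta) .slack))))
    (.seq (.setReal Reg.delta (.const 0) .slack) <|
      .seq (.put Reg.found (.const 1)) <|
      .seq (.put Reg.minRow (.get Reg.row)) (.put Reg.minCol (.get Reg.col)))
    .skip

/-- Find a frontier entry of minimum reduced cost. -/
def scan : Program :=
  .seq (.put Reg.found (.const 0)) (.forGrid Reg.row Reg.col .users scanEntry)

/-- Add `d` to the potentials of the visited rows or columns. -/
def shift (pot seen : ℕ) (d : RealExp) : Program :=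
  .forLoop Reg.row .users <|
    .branch (.isSet (.read seen (.get Reg.row)))
      (.setReal pot (.get Reg.row) (.add (.read pot (.get Reg.row)) d)) .skip

/-- Find the row to which the column of the new entry is matched; there is none if the result is
larger than the current row. -/
def findOwner : Program :=
  .seq (.put Reg.owner (.add (.get Reg.cur) (.const 1))) <|
  .forLoop Reg.idx (.get Reg.cur) <|
    .branch (.conj (.natLe (.read Reg.matching (.entry (.get Reg.cur) (.get Reg.idx)))
        (.get Reg.minCol))
      (.natLe (.get Reg.minCol) (.read Reg.matching (.entry (.get Reg.cur) (.get Reg.idx)))))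
      (.put Reg.owner (.get Reg.idx)) .skip

/-- Copy the matching of the row of the new entry to the owner, and add the new entry. -/
def switch : Program :=
  .seq (.forLoop Reg.idx .users (.setNat Reg.matching (.entry (.get Reg.owner) (.get Reg.idx))
    (.read Reg.matching (.entry (.get Reg.minRow) (.get Reg.idx))))) <|
  .setNat Reg.matching (.entry (.get Reg.owner) (.get Reg.minRow)) (.get Reg.minCol)

/-- Mark the owner and the column of the new entry as visited. -/
def mark : Program :=
  .seq (.setNat Reg.rowSeen (.get Reg.owner) (.const 1))
    (.setNat Reg.colSeen (.get Reg.minCol) (.const 1))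

/-- Make the new entry tight. -/
def tighten : Program :=
  .seq (.shift Reg.rowPot Reg.rowSeen (.get Reg.delta))
    (.shift Reg.colPot Reg.colSeen (.sub .zero (.get Reg.delta)))

/-- Extend the search by the new entry. -/
def advance : Program := .seq findOwner (.seq switch mark)

/-- One step of the search for an augmenting path. -/
def searchStep : Program :=
  .seq scan (.branch (.isSet (.get Reg.found)) (.seq tighten advance) .skip)

/-- Start a search in the current row. -/
def startSearch : Program :=
  .seq (.forLoop Reg.row .users (.setNat Reg.rowSeen (.get Reg.row) (.const 0))) <|
  .seq (.forLoop Reg.row .users (.setNat Reg.colSeen (.get Reg.row) (.const 0))) <|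
  .seq (.setNat Reg.rowSeen (.get Reg.cur) (.const 1)) <|
  .seq (.put Reg.found (.const 1)) (.put Reg.owner (.get Reg.cur))

/-- Extend the matching to the current row. -/
def insertRow : Program :=
  .seq startSearch <|
  .loop (.conj (.isSet (.get Reg.found)) (.natLe (.get Reg.owner) (.get Reg.cur))) searchStep

/-- Start with zero potentials and the empty matching. -/
def startAssign : Program :=
  .seq (.forLoop Reg.row .users (.setReal Reg.rowPot (.get Reg.row) .zero)) <|
  .seq (.forLoop Reg.row .users (.setReal Reg.colPot (.get Reg.row) .zero)) <|
  .seq (.put Reg.cur (.const 0)) (.put Reg.found (.const 1))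

/-- Solve the assignment problem. -/
def assign : Program :=
  .seq startAssign <|
  .loop (.conj (.isSet (.get Reg.found)) (.lt (.get Reg.cur) .users))
    (.seq insertRow (.increment Reg.cur))

/-- Compute the power of the current user with the current order. -/
def fillEntry : Program :=
  .seq (.progression Reg.list Reg.idx (.add (.get Reg.offset) (.get Reg.col))
    (.add .users (.get Reg.gap)) (.get Reg.count)) <|
  .seq (.call (.get Reg.row) Reg.list (.get Reg.count) Reg.answer) <|
  .seq (.setNat Reg.flag (.entry (.get Reg.row) (.get Reg.col)) (.get Reg.answer))
    (.setReal Reg.cost (.entry (.get Reg.row) (.get Reg.col)) (.get Reg.answer))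

/-- Compute the assignment problem of the current block. -/
def fill : Program := .forGrid Reg.row Reg.col .users fillEntry

/-- Compute the total power of the assignment. -/
def computeTotal : Program :=
  .seq (.accumulate Reg.sum Reg.row .users .assignedCost)
    (.accumulate Reg.objective Reg.idx (.get Reg.count) (.get Reg.sum))

/-- Write the assignment into the output. -/
def record : Program :=
  .seq (.forLoop Reg.row .users (.setNat Reg.order (.get Reg.row) .assigned)) <|
  .seq (.forLoop Reg.row .users (.setReal Reg.power (.get Reg.row) .assignedCost)) <|
  .seq (.put Reg.output (.const 1)) <|
  .seq (.setNat Reg.output (.const 1) (.get Reg.count)) <|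
  .seq (.setNat Reg.output (.const 2) (.get Reg.gap)) <|
  .seq (.setNat Reg.output (.const 3) (.get Reg.offset))
    (.setReal Reg.total (.const 0) (.get Reg.objective))

/-- Record the assignment if it is better than the recorded one. -/
def accept : Program :=
  .branch (.conj (.isSet (.get Reg.output)) (.realLe (.get Reg.total) (.get Reg.objective)))
    .skip record

/-- Compare the assignment, if there is one, with the recorded allocation. -/
def compare : Program :=
  .branch (.isSet (.get Reg.found)) (.seq computeTotal accept) .skip

/-- Try the current block. -/
def tryBlock : Program := .seq fill (.seq assign compare)

/-- Try the current block, and move it by one channel. -/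
def tryOffset : Program := .seq tryBlock (.increment Reg.offset)

/-- Try all blocks with the current number of sub blocks and the current gap. -/
def tryOffsets : Program :=
  .seq (.put Reg.offset (.const 0)) (.loop .fitsAtOffset tryOffset)

/-- Try all blocks with the current number of sub blocks and the current gap, and go on to the next
gap. -/
def tryGap : Program :=
  .seq tryOffsets <| .seq (.increment Reg.gap) <|
  .put Reg.length (.add (.get Reg.length) (.sub (.get Reg.count) (.const 1)))

/-- Try all blocks with the current number of sub blocks. -/
def tryGaps : Program :=
  .seq (.put Reg.gap (.const 0)) <| .seq (.put Reg.length (.get Reg.base)) (.loop .hasBlock tryGap)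

/-- Try all blocks with the current number of sub blocks, and go on to the next number. -/
def tryCount : Program :=
  .seq tryGaps <| .seq (.increment Reg.count) (.put Reg.base (.add (.get Reg.base) .users))

/-- Try all blocks. The register `base` holds the length of a block without gaps. -/
def tryCounts : Program :=
  .seq (.put Reg.count (.const 1)) <| .seq (.put Reg.base .users) <|
  .loop (.natLe (.get Reg.base) .channels) tryCount

/-- The algorithm for Min-Power. -/
def minPower : Program :=
  .seq (.progression Reg.rowStart Reg.idx (.const 0) .users .users) tryCounts

end Program

end RAM

namespace RAM

/-- The part of the memory that all programs below rely on: the number of users and the starts of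
the rows of an `(M + 1) × M` matrix. -/
structure Layout (M : ℕ) (σ : State) : Prop where
  users : σ.nat Reg.input 0 = M
  rowStart : ∀ l ≤ M, σ.nat Reg.rowStart l = l * M

/-- The admissible entries of the assignment problem in the memory. -/
def entries (M : ℕ) (σ : State) (i j : ℕ) : Prop :=
  i < M ∧ j < M ∧ 1 ≤ σ.nat Reg.flag (i * M + j)

/-- The cost matrix in the memory. -/
def costs (M : ℕ) (σ : State) (i j : ℕ) : ℝ := σ.real Reg.cost (i * M + j)

/-- The reduced costs in the memory. -/
def slack (M : ℕ) (σ : State) : ℕ → ℕ → ℝ :=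
  Hungarian.slack (costs M σ) (σ.real Reg.rowPot) (σ.real Reg.colPot)

/-- The tight entries in the memory. -/
def tight (M : ℕ) (σ : State) : ℕ → ℕ → Prop :=
  Hungarian.Tight (entries M σ) (costs M σ) (σ.real Reg.rowPot) (σ.real Reg.colPot)

/-- The indices below `M` of the positive cells of an array. -/
def marked (M : ℕ) (σ : State) (a : ℕ) : Set ℕ := {i | i < M ∧ 1 ≤ σ.nat a i}

/-- The frontier in the memory, for the entries `F`. -/
def frontier (M : ℕ) (σ : State) (F : ℕ → ℕ → Prop) : Set (ℕ × ℕ) :=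
  Hungarian.frontier F (marked M σ Reg.rowSeen) (marked M σ Reg.colSeen)

/-- The matching that is kept for the row `r`. -/
def stored (M : ℕ) (σ : State) (r i : ℕ) : ℕ := σ.nat Reg.matching (r * M + i)

/-- The memory holds an optimal assignment of the first `k` rows. -/
structure Matched (M k : ℕ) (σ : State) : Prop where
  dual : Hungarian.IsDual (entries M σ) (costs M σ) (σ.real Reg.rowPot) (σ.real Reg.colPot)
  matching : Hungarian.IsMatching (tight M σ) (Set.Iio k) (stored M σ k)

/-- The memory holds a search from the current row. -/
def Searching (M : ℕ) (σ : State) : Prop :=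
  Hungarian.Search (entries M σ) (costs M σ) (σ.real Reg.rowPot) (σ.real Reg.colPot)
    (Set.Iic (σ.nat Reg.cur 0)) (σ.nat Reg.cur 0) (marked M σ Reg.rowSeen)
    (marked M σ Reg.colSeen) (stored M σ)

/-- The memory holds an optimal assignment of the first `k` rows, or says that there is none. -/
def Assigned (M k : ℕ) (σ : State) : Prop :=
  (σ.nat Reg.found 0 = 1 ∧ Matched M k σ) ∨
  (σ.nat Reg.found 0 = 0 ∧ ∀ ν, ¬ Hungarian.IsMatching (entries M σ) (Set.Iio k) ν)

/-- The search from the current row continues, or it has come to its result. -/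
def Progress (M : ℕ) (σ : State) : Prop :=
  (σ.nat Reg.found 0 = 1 ∧ σ.nat Reg.owner 0 ≤ σ.nat Reg.cur 0 ∧ Searching M σ) ∨
  ((σ.nat Reg.found 0 = 0 ∨ σ.nat Reg.cur 0 < σ.nat Reg.owner 0) ∧
    Assigned M (σ.nat Reg.cur 0 + 1) σ)

/-- The memory `τ` after `switch` and `mark` have extended the search by the new entry. -/
structure Extended (M : ℕ) (σ τ : State) : Prop where
  agree : Agree (.seq .switch .mark) σ τ
  rowSeen : σ.nat Reg.owner 0 < M →
    marked M τ Reg.rowSeen = insert (σ.nat Reg.owner 0) (marked M σ Reg.rowSeen)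
  colSeen : marked M τ Reg.colSeen = insert (σ.nat Reg.minCol 0) (marked M σ Reg.colSeen)
  switched : ∀ r, Set.EqOn (stored M τ r)
    (Function.update (stored M σ) (σ.nat Reg.owner 0)
      (Function.update (stored M σ (σ.nat Reg.minRow 0)) (σ.nat Reg.minRow 0)
        (σ.nat Reg.minCol 0)) r) (Set.Iio M)

/-- The result of a scan of the entries in `S`. -/
def Scanned (M : ℕ) (S : Set (ℕ × ℕ)) (σ : State) : Prop :=
  (σ.nat Reg.found 0 = 0 ∧ Disjoint (frontier M σ (entries M σ)) S) ∨
  (σ.nat Reg.found 0 = 1 ∧ (σ.nat Reg.minRow 0, σ.nat Reg.minCol 0) ∈ frontier M σ (entries M σ) ∧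
    slack M σ (σ.nat Reg.minRow 0) (σ.nat Reg.minCol 0) = σ.real Reg.delta 0 ∧
    ∀ e ∈ frontier M σ (entries M σ) ∩ S, σ.real Reg.delta 0 ≤ slack M σ e.1 e.2)

section

variable {O : ℕ → Finset ℕ → Option ℝ} {M k : ℕ} {σ τ : State} {P : Program}

theorem Agree.layout (h : Agree P σ τ) (hL : Layout M σ)
    (hP : Reg.input ∉ P.natTargets ∧ Reg.rowStart ∉ P.natTargets := by decide) : Layout M τ :=
  ⟨by rw [h.nat _ hP.1, hL.users], fun l hl => by rw [h.nat _ hP.2, hL.rowStart l hl]⟩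

theorem Agree.entries_eq (h : Agree P σ τ) (hP : Reg.flag ∉ P.natTargets := by decide) :
    entries M τ = entries M σ := by
  unfold entries
  rw [h.nat _ hP]

theorem Agree.costs_eq (h : Agree P σ τ) (hP : Reg.cost ∉ P.realTargets := by decide) :
    costs M τ = costs M σ := by
  unfold costs
  rw [h.real _ hP]

theorem Agree.marked_eq (h : Agree P σ τ) {a : ℕ} (hP : a ∉ P.natTargets := by decide) :
    marked M τ a = marked M σ a := by
  unfold marked
  rw [h.nat _ hP]

theorem Agree.stored_eq (h : Agree P σ τ) (hP : Reg.matching ∉ P.natTargets := by decide) :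
    stored M τ = stored M σ := by
  unfold stored
  rw [h.nat _ hP]

theorem Agree.tight_eq (h : Agree P σ τ) (hn : Reg.flag ∉ P.natTargets := by decide)
    (hr : ∀ a ∈ [Reg.cost, Reg.rowPot, Reg.colPot], a ∉ P.realTargets := by decide) :
    tight M τ = tight M σ := by
  unfold tight
  rw [h.entries_eq hn, h.costs_eq (hr _ (by decide)), h.real _ (hr Reg.rowPot (by decide)),
    h.real _ (hr Reg.colPot (by decide))]

theorem Agree.frontier_eq (h : Agree P σ τ)
    (hP : Reg.rowSeen ∉ P.natTargets ∧ Reg.colSeen ∉ P.natTargets := by decide)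
    (F : ℕ → ℕ → Prop) : frontier M τ F = frontier M σ F := by
  unfold frontier
  rw [h.marked_eq hP.1, h.marked_eq hP.2]

theorem Agree.searching (h : Agree P σ τ) (hS : Searching M σ)
    (hn : ∀ a ∈ [Reg.flag, Reg.cur, Reg.rowSeen, Reg.colSeen, Reg.matching], a ∉ P.natTargets
      := by decide)
    (hr : ∀ a ∈ [Reg.cost, Reg.rowPot, Reg.colPot], a ∉ P.realTargets := by decide) :
    Searching M τ := by
  unfold Searching
  rw [h.entries_eq (hn _ (by decide)), h.costs_eq (hr _ (by decide)),
    h.real _ (hr Reg.rowPot (by decide)), h.real _ (hr Reg.colPot (by decide)),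
    h.nat _ (hn Reg.cur (by decide)), h.marked_eq (hn Reg.rowSeen (by decide)),
    h.marked_eq (hn Reg.colSeen (by decide)), h.stored_eq (hn _ (by decide))]
  exact hS

theorem entry_inj {r r' i i' : ℕ} (hi : i < M) (hi' : i' < M) :
    r * M + i = r' * M + i' ↔ r = r' ∧ i = i' := by
  refine ⟨fun h => ?_, fun h => by rw [h.1, h.2]⟩
  have hr : r = r' := by
    simpa [Nat.add_div_of_dvd_right, Nat.div_eq_of_lt, hi, hi', Nat.ne_zero_of_lt hi] using
      congrArg (· / M) h
  exact ⟨hr, by simpa [hr] using h⟩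

theorem stored_of_write {r i v r' i' : ℕ} (h : τ.nat Reg.matching =
      Function.update (σ.nat Reg.matching) (r * M + i) v) (hi : i < M) (hi' : i' < M) :
    stored M τ r' i' = if r' = r ∧ i' = i then v else stored M σ r' i' := by
  simp only [stored, h, Function.update_apply, entry_inj hi' hi]

theorem onFrontier_holds (hL : Layout M σ) {i j : ℕ} (hi : i < M) (hj : j < M)
    (hrow : σ.nat Reg.row 0 = i) (hcol : σ.nat Reg.col 0 = j) :
    Test.onFrontier.Holds σ ↔ (i, j) ∈ frontier M σ (entries M σ) := by
  simp [Hungarian.frontier, frontier, marked, entries, hrow, hcol, hi, hj, hL.rowStart i hi.le]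

theorem eval_slack (hL : Layout M σ) {i j : ℕ} (hi : i < M)
    (hrow : σ.nat Reg.row 0 = i) (hcol : σ.nat Reg.col 0 = j) :
    RealExp.slack.eval σ = slack M σ i j := by
  simp [slack, Hungarian.slack, costs, hrow, hcol, hL.rowStart i hi.le]

theorem Scanned.effect (hL : Layout M σ) {S : Set (ℕ × ℕ)} {i j : ℕ} (hi : i < M) (hj : j < M)
    (hrow : σ.nat Reg.row 0 = i) (hcol : σ.nat Reg.col 0 = j) (h : Scanned M S σ) :
    Scanned M (insert (i, j) S) (Program.scanEntry.effect σ) := by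
  have hF := onFrontier_holds hL hi hj hrow hcol
  have hs := eval_slack hL hi hrow hcol
  rw [Program.scanEntry, Program.effect]
  split_ifs with hb
  · have hlt : σ.nat Reg.found 0 = 0 ∨ slack M σ i j < σ.real Reg.delta 0 := by
      rw [← hs]
      by_contra! hc
      exact hb.2 ⟨Nat.one_le_iff_ne_zero.2 hc.1, hc.2⟩
    generalize hτ : Program.effect _ σ = τ
    have hdelta : τ.real Reg.delta 0 = slack M σ i j := by simp [← hτ, Program.effect, ← hs]
    have hfrontier : frontier M τ (entries M τ) = frontier M σ (entries M σ) := by rw [← hτ]; rfl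
    have hslack : slack M τ = slack M σ := by rw [← hτ]; rfl
    have hmin : τ.nat Reg.minRow 0 = i ∧ τ.nat Reg.minCol 0 = j := by
      simp [← hτ, Program.effect, hrow, hcol]
    refine .inr ⟨by rw [← hτ]; rfl, ?_⟩
    rw [hfrontier, hslack, hdelta, hmin.1, hmin.2]
    refine ⟨hF.1 hb.1, rfl, ?_⟩
    rintro e ⟨he, rfl | heS⟩
    · exact le_rfl
    · obtain ⟨-, hd⟩ | ⟨hf, -, -, hle⟩ := h
      · exact absurd heS (Set.disjoint_left.1 hd he)
      · exact (hlt.resolve_left (by simp [hf])).le.trans (hle e ⟨he, heS⟩)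
  · obtain ⟨hf, hd⟩ | ⟨hf, hmem, hδ, hle⟩ := h
    · refine .inl ⟨hf, Set.disjoint_insert_right.2 ⟨fun hi' => hb ⟨hF.2 hi', ?_⟩, hd⟩⟩
      exact fun hc => by simpa [hf] using hc.1
    · refine .inr ⟨hf, hmem, hδ, ?_⟩
      rintro e ⟨he, rfl | heS⟩
      · exact not_lt.1 fun hc => hb ⟨hF.2 he, fun hc' => hc.not_ge (hc'.2.trans_eq hs)⟩
      · exact hle e ⟨he, heS⟩

theorem runs_scan (hL : Layout M σ) :
    Runs O .scan σ ((M + 3) ^ 2 * 200) (Scanned M (Set.Iio M ×ˢ Set.Iio M)) := by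
  refine (runs_effect σ rfl).seq (T' := (M + 3) ^ 2 * 150) ?_
    (by simp [Program.steps]; ring_nf; lia)
  rintro σ₀ ha₀ rfl
  exact (Runs.forGrid (m := M) (T := 100) (n := .users) (x := Reg.row) (y := Reg.col) (Scanned M)
    (by decide) (by decide) (by decide) (fun σ' h => (h.layout (ha₀.layout hL)).users)
    (fun _ _ _ h => ⟨h, h⟩) (.inl ⟨by simp [Program.effect], by simp⟩)
    fun i hi j hj S σ' ha hrow hcol h => .of_effect rfl (by decide)
      (h.effect (ha.layout (ha₀.layout hL)) hi hj hrow hcol)).mono (by simp) fun _ _ h => h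

end

end RAM

namespace RAM

section

variable {O : ℕ → Finset ℕ → Option ℝ} {M : ℕ} {σ : State}

theorem runs_shift (hL : Layout M σ) {pot seen : ℕ} {d : RealExp} {δ : ℝ} (hseen : seen ≠ Reg.row)
    (hd : ∀ σ', Agree (.shift pot seen d) σ σ' → d.eval σ' = δ) :
    Runs O (.shift pot seen d) σ ((M + 3) * (d.cost + 50)) fun τ =>
      τ.real pot = σ.real pot + (marked M σ seen).indicator fun _ => δ := by
  refine .mono (.sweep (m := M) (T := d.cost + 20) (fun τ => τ.real pot)
    (fun k => if 1 ≤ σ.nat seen k then σ.real pot k + δ else σ.real pot k) (by simp)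
    (fun σ' h => (h.layout hL (by simp [Program.forLoop])).users)
    (fun _ _ => rfl) fun k _ σ' ha hrow hpot => .of_effect rfl (by simp [Program.steps]; lia) ?_)
    (Nat.mul_le_mul_left _ (by simp only [NatExp.cost]; lia)) fun τ _ hτ => hτ.trans ?_
  · have hk : σ'.nat seen k = σ.nat seen k :=
      congrFun (ha.nat seen (by simp [Program.forLoop, hseen])) k
    by_cases h : 1 ≤ σ.nat seen k <;> simp [Program.effect, hrow, hk, h, hd σ' ha, hpot]
  · ext k
    by_cases hk : k < M <;> by_cases h : 1 ≤ σ.nat seen k <;> simp [marked, hk, h]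

theorem runs_findOwner (hL : Layout M σ) (hcur : σ.nat Reg.cur 0 < M) :
    Runs O .findOwner σ ((M + 3) * 100) fun τ =>
      (τ.nat Reg.owner 0 = σ.nat Reg.cur 0 + 1 ∧
        ∀ i < σ.nat Reg.cur 0, stored M σ (σ.nat Reg.cur 0) i ≠ σ.nat Reg.minCol 0) ∨
      (τ.nat Reg.owner 0 < σ.nat Reg.cur 0 ∧
        stored M σ (σ.nat Reg.cur 0) (τ.nat Reg.owner 0) = σ.nat Reg.minCol 0) := by
  refine (runs_effect σ rfl).seq (T' := (M + 3) * 90) ?_ (by simp [Program.steps]; lia)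
  rintro σ₀ ha₀ rfl
  refine .mono (.forLoop (m := σ.nat Reg.cur 0) (T := 40) (n := .get Reg.cur) (x := Reg.idx)
    (fun k τ => (τ.nat Reg.owner 0 = σ.nat Reg.cur 0 + 1 ∧
        ∀ i < k, stored M σ (σ.nat Reg.cur 0) i ≠ σ.nat Reg.minCol 0) ∨
      (τ.nat Reg.owner 0 < σ.nat Reg.cur 0 ∧
        stored M σ (σ.nat Reg.cur 0) (τ.nat Reg.owner 0) = σ.nat Reg.minCol 0)) (by decide)
    (fun σ' h => congrFun (h.nat Reg.cur (by decide)) 0) (fun _ _ _ h => h)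
    (.inl ⟨rfl, by simp⟩) fun k hk σ' ha hidx h => .of_effect rfl (by decide) ?_)
    (Nat.mul_le_mul (by lia) (by decide)) fun _ _ h => h
  have hcur' : σ'.nat Reg.cur 0 = σ.nat Reg.cur 0 := congrFun (ha.nat Reg.cur (by decide)) 0
  have hcol : σ'.nat Reg.minCol 0 = σ.nat Reg.minCol 0 := congrFun (ha.nat Reg.minCol (by decide)) 0
  have hcell : σ'.nat Reg.matching (σ.nat Reg.cur 0 * M + k) = stored M σ (σ.nat Reg.cur 0) k :=
    congrFun (ha.nat Reg.matching (by decide)) _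
  have hL' := ha.layout (ha₀.layout hL)
  by_cases hk' : stored M σ (σ.nat Reg.cur 0) k = σ.nat Reg.minCol 0
  · refine .inr ?_
    simp [Program.effect, hidx, hcur', hcol, hL'.rowStart _ hcur.le, hcell, hk', hk]
  · have hne : ¬ (stored M σ (σ.nat Reg.cur 0) k ≤ σ.nat Reg.minCol 0 ∧
      σ.nat Reg.minCol 0 ≤ stored M σ (σ.nat Reg.cur 0) k) := fun h => hk' (le_antisymm h.1 h.2)
    simp only [Program.effect, Test.Holds, NatExp.eval, hcur', hidx, hcol,
      hL'.rowStart _ hcur.le, hcell, hne, if_false]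
    refine h.imp_left fun h => ⟨h.1, fun i hi => ?_⟩
    obtain rfl | hik := eq_or_ne i k
    · exact hk'
    · exact h.2 i (by lia)

theorem runs_switch (hL : Layout M σ) (hown : σ.nat Reg.owner 0 ≤ M)
    (hrow : σ.nat Reg.minRow 0 < M) :
    Runs O .switch σ ((M + 3) * 100) fun τ => ∀ r, Set.EqOn (stored M τ r)
      (Function.update (stored M σ) (σ.nat Reg.owner 0)
        (Function.update (stored M σ (σ.nat Reg.minRow 0)) (σ.nat Reg.minRow 0)
          (σ.nat Reg.minCol 0)) r) (Set.Iio M) := by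
  generalize ho : σ.nat Reg.owner 0 = own at hown ⊢
  generalize hr : σ.nat Reg.minRow 0 = row at hrow ⊢
  refine .seq (T := (M + 3) * 60) (T' := 30) (R := fun τ => ∀ r, ∀ i < M, stored M τ r i =
    if r = own then stored M σ row i else stored M σ r i) ?_ ?_ (by lia)
  · refine .mono (.forLoop (m := M) (T := 40) (n := .users) (x := Reg.idx)
      (fun k τ => ∀ r, ∀ i < M, stored M τ r i =
        if r = own ∧ i < k then stored M σ row i else stored M σ r i) (by decide)
      (fun σ' h => (h.layout hL).users) (fun _ _ _ h => h) (by simp)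
      fun k hk σ' ha hidx h => .of_effect rfl (by decide) fun r i hi => ?_)
      (by simp) fun τ _ h r i hi => by simpa [hi] using h r i hi
    have hown' : σ'.nat Reg.owner 0 = own := ho ▸ congrFun (ha.nat Reg.owner (by decide)) 0
    have hrow' : σ'.nat Reg.minRow 0 = row := hr ▸ congrFun (ha.nat Reg.minRow (by decide)) 0
    have hL' := ha.layout hL
    rw [stored_of_write (σ := σ') (r := own) (i := k) (v := stored M σ row k) _ hk hi, h r i hi]
    · grind
    · have hsource : σ'.nat Reg.matching (row * M + k) = stored M σ row k := by
        simpa [stored] using h row k hk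
      simp [Program.effect, hown', hrow', hidx, hL'.rowStart _ hown, hL'.rowStart _ hrow.le,
        hsource]
  · intro σ' ha h
    have hown' : σ'.nat Reg.owner 0 = own := ho ▸ congrFun (ha.nat Reg.owner (by decide)) 0
    have hrow' : σ'.nat Reg.minRow 0 = row := hr ▸ congrFun (ha.nat Reg.minRow (by decide)) 0
    have hcol' : σ'.nat Reg.minCol 0 = σ.nat Reg.minCol 0 :=
      congrFun (ha.nat Reg.minCol (by decide)) 0
    refine .of_effect rfl (by decide) fun r i hi => ?_
    rw [stored_of_write (σ := σ') (r := own) (i := row) (v := σ.nat Reg.minCol 0) _ hrow hi,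
      h r i hi]
    · simp only [Function.update_apply]
      grind
    · simp [Program.effect, hown', hrow', hcol', (ha.layout hL).rowStart _ hown]

theorem marked_of_write {τ : State} {a k : ℕ} (h : τ.nat a = Function.update (σ.nat a) k 1)
    (hk : k < M) : marked M τ a = insert k (marked M σ a) := by
  ext l
  obtain rfl | hl := eq_or_ne l k <;> simp [marked, *]

theorem runs_tighten (hL : Layout M σ) (hS : Searching M σ)
    (he : (σ.nat Reg.minRow 0, σ.nat Reg.minCol 0) ∈ frontier M σ (entries M σ))
    (hδ : slack M σ (σ.nat Reg.minRow 0) (σ.nat Reg.minCol 0) = σ.real Reg.delta 0)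
    (hmin : ∀ e ∈ frontier M σ (entries M σ), σ.real Reg.delta 0 ≤ slack M σ e.1 e.2) :
    Runs O .tighten σ ((M + 3) * 200) fun τ =>
      Searching M τ ∧ (τ.nat Reg.minRow 0, τ.nat Reg.minCol 0) ∈ frontier M τ (tight M τ) := by
  have hδ0 : 0 ≤ σ.real Reg.delta 0 := hδ ▸ hS.dual _ _ he.2.2
  refine .mono (.seq (runs_shift hL (by decide) fun σ' ha => congrFun (ha.real _ (by decide)) 0)
    (fun σ₁ ha₁ h₁ => .mono (runs_shift (δ := - σ.real Reg.delta 0) (ha₁.layout hL) (by decide)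
      fun σ' ha => ?_) le_rfl (R' := fun τ =>
        τ.real Reg.rowPot = σ.real Reg.rowPot +
          (marked M σ Reg.rowSeen).indicator (fun _ => σ.real Reg.delta 0) ∧
        τ.real Reg.colPot = σ.real Reg.colPot -
          (marked M σ Reg.colSeen).indicator (fun _ => σ.real Reg.delta 0)) ?_) le_rfl)
    (by simp; lia) fun τ ha h => ?_
  · simp (disch := decide) [ha.real, ha₁.real]
  · intro τ ha h₂
    refine ⟨by rw [ha.real _ (by decide), h₁], ?_⟩
    rw [h₂, ha₁.marked_eq, ha₁.real Reg.colPot (by decide), sub_eq_add_neg, ← Set.indicator_neg']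
    rfl
  · have hS' := Hungarian.Search.shift hS hδ0 hmin
    have he' := Hungarian.frontier_shift he hδ
    rw [Searching, frontier, tight, ha.entries_eq, ha.costs_eq, ha.marked_eq, ha.marked_eq,
      ha.stored_eq, ha.nat Reg.cur (by decide), ha.nat Reg.minRow (by decide),
      ha.nat Reg.minCol (by decide), h.1, h.2]
    exact ⟨hS', he'⟩

theorem runs_extend (hL : Layout M σ) (hown : σ.nat Reg.owner 0 ≤ M)
    (hrow : σ.nat Reg.minRow 0 < M) (hcol : σ.nat Reg.minCol 0 < M) :
    Runs O (.seq .switch .mark) σ ((M + 3) * 110) (Extended M σ) := by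
  refine .mono (R := fun τ => (σ.nat Reg.owner 0 < M →
        marked M τ Reg.rowSeen = insert (σ.nat Reg.owner 0) (marked M σ Reg.rowSeen)) ∧
      marked M τ Reg.colSeen = insert (σ.nat Reg.minCol 0) (marked M σ Reg.colSeen) ∧
      ∀ r, Set.EqOn (stored M τ r) (Function.update (stored M σ) (σ.nat Reg.owner 0)
        (Function.update (stored M σ (σ.nat Reg.minRow 0)) (σ.nat Reg.minRow 0)
          (σ.nat Reg.minCol 0)) r) (Set.Iio M))
    (.seq (T' := 20) (runs_switch hL hown hrow) (fun σ₁ ha₁ h₁ => .of_effect rfl (by decide)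
      ⟨fun h => ?_, ?_, h₁⟩) le_rfl) (by lia) fun τ ha h => ⟨ha, h.1, h.2.1, h.2.2⟩
  · rw [← ha₁.marked_eq]
    refine marked_of_write ?_ h
    simp [Program.mark, Program.effect, ha₁.nat Reg.owner (by decide)]
  · rw [← ha₁.marked_eq]
    refine marked_of_write ?_ hcol
    simp [Program.mark, Program.effect, ha₁.nat Reg.minCol (by decide)]

theorem Extended.searching (h : Extended M σ τ) (hcur : σ.nat Reg.cur 0 < M)
    (hS : Searching M σ)
    (he : (σ.nat Reg.minRow 0, σ.nat Reg.minCol 0) ∈ frontier M σ (tight M σ))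
    (hown : σ.nat Reg.owner 0 < σ.nat Reg.cur 0)
    (hj : stored M σ (σ.nat Reg.cur 0) (σ.nat Reg.owner 0) = σ.nat Reg.minCol 0) :
    Searching M τ := by
  have ha := h.agree
  rw [Searching, ha.entries_eq, ha.costs_eq, ha.real Reg.rowPot (by decide),
    ha.real Reg.colPot (by decide), ha.nat Reg.cur (by decide), h.rowSeen (hown.trans hcur),
    h.colSeen]
  exact (Hungarian.Search.visit hS he ⟨hown.le, hown.ne⟩ hj).congr fun r _ =>
    (h.switched r).mono (Set.Iic_subset_Iio.2 hcur)

theorem Extended.matched (h : Extended M σ τ) (hcur : σ.nat Reg.cur 0 < M)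
    (hS : Searching M σ)
    (he : (σ.nat Reg.minRow 0, σ.nat Reg.minCol 0) ∈ frontier M σ (tight M σ))
    (hown : σ.nat Reg.owner 0 = σ.nat Reg.cur 0 + 1)
    (hfree : ∀ i < σ.nat Reg.cur 0, stored M σ (σ.nat Reg.cur 0) i ≠ σ.nat Reg.minCol 0) :
    Matched M (σ.nat Reg.cur 0 + 1) τ := by
  have ha := h.agree
  have hμ := Hungarian.Search.augment hS he fun i hi => hfree i (lt_of_le_of_ne hi.1 hi.2)
  have hstored := h.switched (σ.nat Reg.cur 0 + 1)
  rw [hown, Function.update_self] at hstored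
  refine ⟨?_, ?_⟩
  · rw [ha.entries_eq, ha.costs_eq, ha.real Reg.rowPot (by decide),
      ha.real Reg.colPot (by decide)]
    exact hS.dual
  · rw [tight, ha.entries_eq, ha.costs_eq, ha.real Reg.rowPot (by decide),
      ha.real Reg.colPot (by decide)]
    rw [← Order.succ_eq_add_one, Order.Iio_succ]
    exact hμ.congr (hstored.mono (Set.Iic_subset_Iio.2 hcur))

theorem runs_advance (hL : Layout M σ) (hcur : σ.nat Reg.cur 0 < M) (hS : Searching M σ)
    (he : (σ.nat Reg.minRow 0, σ.nat Reg.minCol 0) ∈ frontier M σ (tight M σ))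
    (hf : σ.nat Reg.found 0 = 1) :
    Runs O .advance σ ((M + 3) * 250) fun τ => Progress M τ ∧
      (τ.nat Reg.owner 0 ≤ τ.nat Reg.cur 0 →
        marked M σ Reg.rowSeen ⊂ marked M τ Reg.rowSeen) := by
  refine .seq (T' := (M + 3) * 110) (runs_findOwner hL hcur) (fun σ₁ ha₁ h₁ => ?_) (by lia)
  have he₁ : (σ₁.nat Reg.minRow 0, σ₁.nat Reg.minCol 0) ∈ frontier M σ₁ (tight M σ₁) := by
    rwa [ha₁.frontier_eq, ha₁.tight_eq, ha₁.nat _ (by decide), ha₁.nat _ (by decide)]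
  rw [← ha₁.nat Reg.cur (by decide), ← ha₁.stored_eq, ← ha₁.nat Reg.minCol (by decide)] at h₁
  rw [← ha₁.nat Reg.cur (by decide)] at hcur
  have hS₁ := ha₁.searching hS
  refine .mono (runs_extend (ha₁.layout hL) (by lia) he₁.1.1 he₁.2.2.1.2.1) le_rfl
    fun τ ha h => ?_
  have hτ : τ.nat Reg.owner 0 = σ₁.nat Reg.owner 0 ∧ τ.nat Reg.cur 0 = σ₁.nat Reg.cur 0 ∧
      τ.nat Reg.found 0 = 1 := by
    refine ⟨?_, ?_, ?_⟩ <;> rw [ha.nat _ (by decide)]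
    rw [ha₁.nat _ (by decide), hf]
  rw [Progress, hτ.1, hτ.2.1, hτ.2.2]
  obtain ⟨hown, hfree⟩ | ⟨hown, hj⟩ := h₁
  · refine ⟨.inr ⟨by lia, .inl ⟨hτ.2.2, h.matched hcur hS₁ he₁ hown hfree⟩⟩, by lia⟩
  · refine ⟨.inl ⟨rfl, hown.le, h.searching hcur hS₁ he₁ hown hj⟩, fun _ => ?_⟩
    rw [h.rowSeen (hown.trans hcur), ← ha₁.marked_eq]
    exact Set.ssubset_insert (Hungarian.Search.notMem_of_match hS₁ ⟨hown.le, hown.ne⟩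
      (hj ▸ he₁.2.1))

theorem runs_searchStep (hL : Layout M σ) (hcur : σ.nat Reg.cur 0 < M) (hS : Searching M σ) :
    Runs O .searchStep σ ((M + 3) ^ 2 * 400) fun τ => Progress M τ ∧
      (1 ≤ τ.nat Reg.found 0 → τ.nat Reg.owner 0 ≤ τ.nat Reg.cur 0 →
        marked M σ Reg.rowSeen ⊂ marked M τ Reg.rowSeen) := by
  refine .seq (runs_scan hL) (T' := (M + 3) * 460 + 5) (fun σ₁ ha₁ h₁ => .mono (.branch
    (T := (M + 3) * 460) (fun hb => ?_) fun hb => .of_effect rfl ?_ ?_) (by simp; lia)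
    fun _ _ h => h) (by ring_nf; lia)
  · have hS₁ := ha₁.searching hS
    obtain ⟨hf, -⟩ | ⟨hf, he, hδ, hmin⟩ := h₁
    · simp [hf] at hb
    refine .seq (T' := (M + 3) * 250) (runs_tighten (ha₁.layout hL) hS₁ he hδ fun e he => ?_)
      (fun σ₂ ha₂ h₂ => ?_) (by lia)
    · exact hmin e ⟨he, he.2.2.1, he.2.2.2.1⟩
    · refine .mono (runs_advance (ha₂.layout (ha₁.layout hL)) ?_ h₂.1 h₂.2 ?_) le_rfl
        fun τ _ h => ⟨h.1, fun _ => ?_⟩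
      · rwa [ha₂.nat _ (by decide), ha₁.nat _ (by decide)]
      · rw [ha₂.nat _ (by decide), hf]
      · rw [← ha₁.marked_eq, ← ha₂.marked_eq]
        exact h.2
  · simp [Program.steps]; lia
  · have hf : σ₁.nat Reg.found 0 = 0 := by simpa using hb
    obtain ⟨-, hd⟩ | ⟨hf', -⟩ := h₁
    · refine ⟨.inr ⟨.inl hf, .inr ⟨hf, fun ν => ?_⟩⟩, fun h =>
        absurd hf (Nat.one_le_iff_ne_zero.1 h)⟩
      rw [← Order.succ_eq_add_one, Order.Iio_succ]
      refine Hungarian.Search.not_isMatching (ha₁.searching hS)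
        ((Set.finite_Iio M).subset fun i hi => hi.1) (Set.eq_empty_iff_forall_notMem.2 ?_) ν
      exact fun e he => Set.disjoint_left.1 hd he ⟨he.2.2.1, he.2.2.2.1⟩
    · simp [hf] at hf'

theorem runs_clear (hL : Layout M σ) {a : ℕ} (ha : a ∉ [Reg.row, Reg.input, Reg.rowStart]) :
    Runs O (.forLoop Reg.row .users (.setNat a (.get Reg.row) (.const 0))) σ ((M + 3) * 50)
      (marked M · a = ∅) := by
  have hne : ∀ b ∈ [Reg.row, Reg.input, Reg.rowStart], a ≠ b := fun b hb h => ha (h ▸ hb)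
  refine .mono (.sweep (m := M) (T := 20) (fun τ => τ.nat a) (fun _ => 0)
    (by simp [(hne Reg.row (by decide)).symm]) (fun σ' h => (h.layout hL ?_).users)
    (fun _ _ => by simp [hne Reg.row (by decide)]) fun k _ σ' _ hrow _ =>
      .of_effect rfl (by simp [Program.steps]) (by simp [Program.effect, hrow]))
    (by simp) fun τ _ h => ?_
  · simp [Program.forLoop, (hne Reg.input (by decide)).symm, (hne Reg.rowStart (by decide)).symm]
  · ext i
    simp +contextual [marked, h]

theorem runs_clearReal (hL : Layout M σ) (a : ℕ) :
    Runs O (.forLoop Reg.row .users (.setReal a (.get Reg.row) .zero)) σ ((M + 3) * 50)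
      fun τ => ∀ i < M, τ.real a i = 0 := by
  refine .mono (.sweep (m := M) (T := 20) (fun τ => τ.real a) (fun _ => 0) (by simp)
    (fun σ' h => (h.layout hL (by simp [Program.forLoop])).users) (fun _ _ => rfl)
    fun k _ σ' _ hrow _ => .of_effect rfl (by simp [Program.steps])
      (by simp [Program.effect, hrow])) (by simp) fun τ _ h i hi => by simp [h, hi]

theorem runs_startSearch (hL : Layout M σ) (hcur : σ.nat Reg.cur 0 < M)
    (hσ : Matched M (σ.nat Reg.cur 0) σ) :
    Runs O .startSearch σ ((M + 3) * 120) (Progress M) := by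
  refine .mono (R := fun τ => τ.nat Reg.found 0 = 1 ∧ τ.nat Reg.owner 0 = σ.nat Reg.cur 0 ∧
      marked M τ Reg.rowSeen = {σ.nat Reg.cur 0} ∧ marked M τ Reg.colSeen = ∅)
    (.seq (T' := (M + 3) * 60) (runs_clear hL (by decide)) (fun σ₁ ha₁ h₁ =>
      .seq (T' := 20) (runs_clear (ha₁.layout hL) (by decide)) (fun σ₂ ha₂ h₂ =>
        .of_effect rfl (by decide) ⟨?_, ?_, ?_, h₂⟩) (by lia)) le_rfl) (by lia) fun τ ha h => ?_
  · simp [Program.effect]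
  · simp (disch := decide) [Program.effect, ha₂.nat, ha₁.nat]
  · rw [← insert_empty_eq, ← h₁, ← ha₂.marked_eq]
    exact marked_of_write (by simp (disch := decide) [Program.effect, ha₂.nat, ha₁.nat]) hcur
  · have hcurτ : τ.nat Reg.cur 0 = σ.nat Reg.cur 0 := congrFun (ha.nat _ (by decide)) 0
    refine .inl ⟨h.1, (h.2.1.trans hcurτ.symm).le, ?_⟩
    rw [Searching, h.2.2.1, h.2.2.2, hcurτ]
    refine .start ?_ Set.self_mem_Iic ?_
    · rw [ha.entries_eq, ha.costs_eq, ha.real _ (by decide), ha.real _ (by decide)]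
      exact hσ.dual
    · rw [Set.Iic_sdiff_right, ha.stored_eq]
      change Hungarian.IsMatching (tight M τ) _ _
      rw [ha.tight_eq]
      exact hσ.matching

theorem runs_insertRow (hL : Layout M σ) (hcur : σ.nat Reg.cur 0 < M)
    (hσ : Matched M (σ.nat Reg.cur 0) σ) :
    Runs O .insertRow σ ((M + 3) ^ 3 * 500) fun τ => Assigned M (τ.nat Reg.cur 0 + 1) τ := by
  refine .seq (T' := (M + 3) ^ 3 * 450) (runs_startSearch hL hcur hσ) (fun σ₁ ha₁ h₁ =>
    .mono (.loop (T := (M + 3) ^ 2 * 400) (Progress M)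
      (fun τ => M - (marked M τ Reg.rowSeen).ncard) h₁ fun σ₂ ha₂ h₂ hb => ?_) ?_
      fun τ _ h => ?_) (by ring_nf; lia)
  · obtain ⟨-, -, hS⟩ | ⟨h, -⟩ := h₂
    · refine .mono (runs_searchStep (ha₂.layout (ha₁.layout hL)) ?_ hS) le_rfl fun τ _ h =>
        ⟨h.1, fun hb => ?_⟩
      · rwa [ha₂.nat _ (by decide), ha₁.nat _ (by decide)]
      · have hsub : marked M τ Reg.rowSeen ⊆ Set.Iio M := fun i hi => hi.1
        have hlt := Set.ncard_lt_ncard (h.2 hb.1 hb.2) ((Set.finite_Iio M).subset hsub)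
        have hle := (Set.ncard_le_ncard hsub).trans_eq (Set.ncard_Iio_nat M)
        lia
    · simp at hb
      lia
  · calc _ ≤ (M + 3) * ((M + 3) ^ 2 * 410) := Nat.mul_le_mul (by lia) (by simp; ring_nf; lia)
      _ ≤ (M + 3) ^ 3 * 450 := by ring_nf; lia
  · refine (h.1.resolve_left fun hS => h.2 ?_).2
    simp [hS.1, hS.2.1]

theorem runs_startAssign (hL : Layout M σ)
    (hpos : ∀ i j, entries M σ i j → 0 ≤ costs M σ i j) :
    Runs O .startAssign σ ((M + 3) * 130) fun τ => τ.nat Reg.cur 0 = 0 ∧ Assigned M 0 τ := by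
  refine .mono (R := fun τ => τ.nat Reg.cur 0 = 0 ∧ τ.nat Reg.found 0 = 1 ∧
      (∀ i < M, τ.real Reg.rowPot i = 0) ∧ ∀ j < M, τ.real Reg.colPot j = 0)
    (.seq (T' := (M + 3) * 70) (runs_clearReal hL _) (fun σ₁ ha₁ h₁ =>
      .seq (T' := 20) (runs_clearReal (ha₁.layout hL) _) (fun σ₂ ha₂ h₂ =>
        .of_effect rfl (by decide) ⟨rfl, rfl, fun i hi => ?_, h₂⟩) (by lia)) le_rfl) (by lia)
      fun τ ha h => ⟨h.1, .inl ⟨h.2.1, fun i j hij => ?_, by simp, by simp⟩⟩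
  · exact (congrFun (ha₂.real _ (by decide)) i).trans (h₁ i hi)
  · rw [Hungarian.slack, h.2.2.1 i hij.1, h.2.2.2 j hij.2.1, sub_zero, sub_zero, ha.costs_eq]
    rw [ha.entries_eq] at hij
    exact hpos i j hij

theorem runs_assign (hL : Layout M σ) (hpos : ∀ i j, entries M σ i j → 0 ≤ costs M σ i j) :
    Runs O .assign σ ((M + 3) ^ 4 * 600) (Assigned M M) := by
  refine .seq (T' := (M + 3) ^ 4 * 550) (runs_startAssign hL hpos) (fun σ₁ ha₁ h₁ =>
    .mono (.loop (T := (M + 3) ^ 3 * 510)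
      (fun τ => τ.nat Reg.cur 0 ≤ M ∧ Assigned M (τ.nat Reg.cur 0) τ)
      (fun τ => M - τ.nat Reg.cur 0) ⟨by lia, h₁.1.symm ▸ h₁.2⟩ fun σ₂ ha₂ h₂ hb => ?_) ?_
      fun τ ha h => ?_) (by ring_nf; lia)
  · have hL₂ := ha₂.layout (ha₁.layout hL)
    obtain ⟨hf, hcur⟩ : 1 ≤ σ₂.nat Reg.found 0 ∧ σ₂.nat Reg.cur 0 < M := by
      simpa [hL₂.users] using hb
    have hσ₂ : Matched M (σ₂.nat Reg.cur 0) σ₂ :=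
      (h₂.2.resolve_right fun h => by simp [h.1] at hf).2
    refine .seq (T' := 10) (runs_insertRow hL₂ hcur hσ₂) (fun σ₃ ha₃ h₃ =>
      .of_effect rfl (by decide) ?_) (by ring_nf; lia)
    have hcur₃ : σ₃.nat Reg.cur 0 = σ₂.nat Reg.cur 0 := congrFun (ha₃.nat _ (by decide)) 0
    have hcurτ : (Program.effect (.increment Reg.cur) σ₃).nat Reg.cur 0 = σ₃.nat Reg.cur 0 + 1 := by
      simp [Program.effect]
    rw [hcurτ]
    exact ⟨⟨by lia, h₃.imp (fun h => ⟨h.1, h.2.dual, h.2.matching⟩) id⟩, by lia⟩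
  · rw [h₁.1]
    calc _ ≤ (M + 3) * ((M + 3) ^ 3 * 530) := Nat.mul_le_mul (by lia) (by simp; ring_nf; lia)
      _ ≤ (M + 3) ^ 4 * 550 := by ring_nf; lia
  · have hM := (ha.layout (ha₁.layout hL)).users
    have hb : 1 ≤ τ.nat Reg.found 0 → M ≤ τ.nat Reg.cur 0 := by simpa [hM] using h.2
    obtain ⟨hle, ⟨hf, hm⟩ | ⟨hf, hm⟩⟩ := h.1
    · exact .inl ⟨hf, (hle.antisymm (hb hf.ge)) ▸ hm⟩
    · exact .inr ⟨hf, fun ν hν => hm ν (hν.mono (Set.Iio_subset_Iio hle) fun _ _ => id)⟩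

end

end RAM

namespace IFDMA

variable {M N : ℕ}

theorem Block.isValid_iff (hM : 1 ≤ M) {b : Block} :
    b.IsValid M N ↔ 1 ≤ b.c ∧ (b.c = 1 → b.s = 0) ∧ b.q + b.length M ≤ N := by
  obtain ⟨c, s, q⟩ := b
  simp only [Block.IsValid, Block.length, Nat.le_div_iff_mul_le hM]
  rcases c with - | c
  · simp
  have hlength : c * (M + s) + M = (c + 1) * M + s * c := by ring
  rw [Nat.add_sub_cancel, hlength]
  constructor
  · rintro ⟨h1, hc, h0, hs, hq⟩
    have hsc : s * c ≤ N - (c + 1) * M := by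
      obtain rfl | hpos := Nat.eq_zero_or_pos c
      · simp
      · exact (Nat.le_div_iff_mul_le hpos).1 (hs (by lia))
    exact ⟨h1, h0, by lia⟩
  · rintro ⟨h1, h0, hq⟩
    refine ⟨h1, by lia, h0, fun h2 => ?_, by lia⟩
    rw [Nat.le_div_iff_mul_le (by lia)]
    lia

theorem Block.encard_isValid_le (hM : 1 ≤ M) :
    {b : Block | b.IsValid M N}.encard ≤ (((N + 1) + (N + 1) ^ 3 : ℕ) : ℕ∞) := by
  have hinj : Function.Injective fun b : Block => (b.c, b.s, b.q) := by
    rintro ⟨c, s, q⟩ ⟨c', s', q'⟩ h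
    simpa using h
  let box : Finset (ℕ × ℕ × ℕ) :=
    Finset.range (N + 1) ×ˢ Finset.range (N + 1) ×ˢ Finset.range (N + 1)
  have hmaps : Set.MapsTo (fun b : Block => (b.c, b.s, b.q)) {b | b.IsValid M N} box := by
    intro b hb
    obtain ⟨h1, h0, hq⟩ := (Block.isValid_iff hM).1 hb
    have hc : b.c - 1 ≤ (b.c - 1) * (M + b.s) := Nat.le_mul_of_pos_right _ (by lia)
    have hs : b.s ≤ (b.c - 1) * (M + b.s) := by
      obtain h | h := h1.eq_or_lt
      · simp [h0 h.symm]
      · exact le_trans (by lia) (Nat.le_mul_of_pos_left _ (by lia))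
    rw [Block.length] at hq
    simp only [box, Finset.coe_product, Finset.coe_range, Set.mem_prod, Set.mem_Iio]
    lia
  calc {b : Block | b.IsValid M N}.encard ≤ (box : Set (ℕ × ℕ × ℕ)).encard :=
        Set.encard_le_encard_of_injOn hmaps hinj.injOn
    _ = (((N + 1) ^ 3 : ℕ) : ℕ∞) := by
        rw [Set.encard_coe_eq_coe_finsetCard, Finset.card_product, Finset.card_product,
          Finset.card_range]
        congr 1
        ring
    _ ≤ _ := by exact_mod_cast Nat.le_add_left _ _

theorem Block.channel_lt (hM : 1 ≤ M) {b : Block} (hb : b.IsValid M N) (v : Fin M) {k : ℕ}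
    (hk : k < b.c) : b.q + k * (M + b.s) + v < N := by
  have hle : k * (M + b.s) ≤ (b.c - 1) * (M + b.s) := Nat.mul_le_mul_right _ (by lia)
  have hq := ((Block.isValid_iff hM).1 hb).2.2
  rw [Block.length] at hq
  lia

/-- The channels of `Block.channels` as natural numbers. -/
def Block.natChannels (b : Block) (M v : ℕ) : Finset ℕ :=
  (Finset.range b.c).image fun k => b.q + k * (M + b.s) + v

theorem Block.filter_mem_natChannels (b : Block) (v : Fin M) :
    ({j : Fin N | (j : ℕ) ∈ b.natChannels M v} : Finset (Fin N)) = b.channels M N v := by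
  ext j
  simp [Block.natChannels, Block.channels, eq_comm]

theorem Block.map_channels (hM : 1 ≤ M) {b : Block} (hb : b.IsValid M N) (v : Fin M) :
    (b.channels M N v).map Fin.valEmbedding = b.natChannels M v := by
  ext n
  simp only [channels, natChannels, Finset.mem_map, Finset.mem_filter, Finset.mem_univ, true_and,
    Finset.mem_image, Finset.mem_range, Fin.valEmbedding_apply]
  constructor
  · rintro ⟨j, ⟨k, hk, hj⟩, rfl⟩
    exact ⟨k, hk, hj.symm⟩
  · rintro ⟨k, hk, rfl⟩
    exact ⟨⟨_, channel_lt hM hb v hk⟩, ⟨k, hk, rfl⟩, rfl⟩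

theorem Block.card_channels (hM : 1 ≤ M) {b : Block} (hb : b.IsValid M N) (v : Fin M) :
    (b.channels M N v).card = b.c := by
  rw [← Finset.card_map, map_channels hM hb v, natChannels, Finset.card_image_of_injective,
    Finset.card_range]
  intro k k' h
  exact Nat.eq_of_mul_eq_mul_right (show 0 < M + b.s by lia) (by simpa using h)

theorem Allocation.totalPower_eq (hM : 1 ≤ M) {a : Allocation M} (ha : a.block.IsValid M N) :
    a.totalPower N = a.block.c * ∑ i, a.power i := by
  simp only [Allocation.totalPower, Finset.sum_const, Block.card_channels hM ha, nsmul_eq_mul,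
    Finset.mul_sum]

namespace Instance

variable (I : Instance M N)

theorem isLeast_of_minPower_isSome {b : Block} {i v : Fin M}
    (h : (I.minPower i (b.natChannels M v)).isSome) :
    IsLeast (I.admissible i (b.channels M N v)) ((I.minPower i (b.natChannels M v)).getD 0) := by
  unfold minPower at h ⊢
  split_ifs at h ⊢ with hex
  · rw [← Block.filter_mem_natChannels]
    exact hex.choose_spec.choose_spec
  · simp at h

theorem minPower_isSome (hI : I.HasMinima) {b : Block} (hb : b.IsValid M N) {i v : Fin M} {p : ℝ}
    (hp : p ∈ I.admissible i (b.channels M N v)) :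
    (I.minPower i (b.natChannels M v)).isSome := by
  obtain ⟨p₀, hp₀⟩ := hI b hb i v ⟨p, hp⟩
  rw [minPower, dif_pos ⟨i.2, p₀, by rwa [Block.filter_mem_natChannels]⟩]
  rfl

/-- The admissible entries of the assignment problem of a block: user `i` can have order `v`. -/
def Fits (b : Block) (i v : ℕ) : Prop :=
  i < M ∧ v < M ∧ (I.minPower i (b.natChannels M v)).isSome

/-- The power of user `i` with order `v` in the block `b`; it is `0` unless `I.Fits b i v`. -/
noncomputable def cost (b : Block) (i v : ℕ) : ℝ := (I.minPower i (b.natChannels M v)).getD 0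

variable {I}

theorem Fits.isLeast {b : Block} {i v : Fin M} (h : I.Fits b i v) :
    IsLeast (I.admissible i (b.channels M N v)) (I.cost b i v) :=
  I.isLeast_of_minPower_isSome h.2.2

theorem Fits.cost_nonneg {b : Block} {i v : ℕ} (h : I.Fits b i v) : 0 ≤ I.cost b i v :=
  (isLeast (i := ⟨i, h.1⟩) (v := ⟨v, h.2.1⟩) h).1.1

theorem IsFeasible.exists_isMatching (hM : 1 ≤ M) (hI : I.HasMinima) {a : Allocation M}
    (ha : I.IsFeasible a) :
    ∃ ν : ℕ → ℕ, Hungarian.IsMatching (I.Fits a.block) (Set.Iio M) ν ∧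
      a.block.c * ∑ i ∈ Finset.range M, I.cost a.block i (ν i) ≤ a.totalPower N := by
  let ν : ℕ → ℕ := fun i => if h : i < M then a.order ⟨i, h⟩ else 0
  have hν : ∀ i : Fin M, ν i = a.order i := fun i => by simp [ν]
  have hfits : ∀ i : Fin M, I.Fits a.block i (a.order i) := fun i =>
    ⟨i.2, (a.order i).2, I.minPower_isSome hI ha.1 (ha.2 i)⟩
  refine ⟨ν, ⟨fun i hi => ?_, fun i hi j hj hij => ?_⟩, ?_⟩
  · rw [hν ⟨i, hi⟩]
    exact hfits ⟨i, hi⟩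
  · rw [hν ⟨i, hi⟩, hν ⟨j, hj⟩] at hij
    exact congrArg Fin.val (a.order.injective (Fin.ext hij))
  · rw [a.totalPower_eq hM ha.1, Finset.sum_range]
    gcongr with i
    rw [hν]
    exact (hfits i).isLeast.2 (ha.2 i)

theorem exists_allocation_of_isMatching {b : Block} (hb : b.IsValid M N) {μ : ℕ → ℕ}
    (hμ : Hungarian.IsMatching (I.Fits b) (Set.Iio M) μ) :
    ∃ a : Allocation M, I.IsFeasible a ∧ a.block = b ∧ (∀ i : Fin M, (a.order i : ℕ) = μ i) ∧
      ∀ i : Fin M, a.power i = I.cost b i (μ i) := by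
  let f : Fin M → Fin M := fun i => ⟨μ i, (hμ.edge i i.2).2.1⟩
  have hf : Function.Injective f := fun i j hij =>
    Fin.ext (hμ.injOn i.2 j.2 (congrArg Fin.val hij))
  exact ⟨⟨b, .ofBijective f (Finite.injective_iff_bijective.1 hf), fun i => I.cost b i (μ i)⟩,
    ⟨hb, fun i => (Fits.isLeast (v := f i) (hμ.edge i i.2)).1⟩, rfl, fun _ => rfl, fun _ => rfl⟩

end Instance

end IFDMA

namespace RAM

open IFDMA

/-- The current block. -/
abbrev State.block (σ : State) : Block :=
  ⟨σ.nat Reg.count 0, σ.nat Reg.gap 0, σ.nat Reg.offset 0⟩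

/-- The assignment problem in the memory is the one of the block `b`. -/
structure Filled {M N : ℕ} (I : Instance M N) (b : Block) (σ : State) : Prop where
  entries_eq : entries M σ = I.Fits b
  costs_eq : ∀ i < M, ∀ j < M, costs M σ i j = I.cost b i j

/-- The memory holds the allocation `a` as a candidate for the output. -/
structure Proposes {M : ℕ} (σ : State) (a : Allocation M) : Prop where
  block : a.block = σ.block
  order : ∀ i : Fin M, (a.order i : ℕ) = stored M σ M i
  power : ∀ i : Fin M, a.power i = costs M σ i (a.order i)

section

variable {O : ℕ → Finset ℕ → Option ℝ} {M N : ℕ} {I : Instance M N} {σ τ : State} {P : Program}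

theorem Agree.block_eq (h : Agree P σ τ)
    (hP : ∀ a ∈ [Reg.count, Reg.gap, Reg.offset], a ∉ P.natTargets := by decide) :
    τ.block = σ.block := by
  simp only [State.block, h.nat _ (hP Reg.count (by decide)), h.nat _ (hP Reg.gap (by decide)),
    h.nat _ (hP Reg.offset (by decide))]

theorem runs_fillEntry (hL : Layout M σ) {i j : ℕ} (hi : i < M) (hrow : σ.nat Reg.row 0 = i)
    (hcol : σ.nat Reg.col 0 = j) :
    Runs O .fillEntry σ ((σ.nat Reg.count 0 + 3) * 60) fun τ =>
      τ.nat Reg.flag = Function.update (σ.nat Reg.flag) (i * M + j)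
        (if (O i (σ.block.natChannels M j)).isSome then 1 else 0) ∧
      τ.real Reg.cost = Function.update (σ.real Reg.cost) (i * M + j)
        ((O i (σ.block.natChannels M j)).getD 0) := by
  refine .seq (T' := σ.nat Reg.count 0 + 30) (.progression (m := σ.nat Reg.count 0)
    (M + σ.nat Reg.gap 0) (by decide) (fun σ' h => ?_) fun σ' h => congrFun (h.nat _ (by decide)) 0)
    (fun σ₁ ha₁ h₁ => .seq (T' := 20) (.call _ _ _ _ _) (fun σ₂ _ h₂ =>
      .of_effect rfl (by decide) ?_) ?_) (by simp; lia)
  · simp (disch := decide) [h.nat, hL.users]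
  · have hlisted : σ₁.listed Reg.list (σ₁.nat Reg.count 0) = σ.block.natChannels M j := by
      rw [State.listed, Block.natChannels, ha₁.nat Reg.count (by decide)]
      refine Finset.image_congr fun l hl => ?_
      rw [h₁ l (by simpa using (Finset.mem_range.1 hl).le)]
      simp [hcol, add_right_comm]
    have hanswer : σ₂ = σ₁.answer Reg.answer (O i (σ.block.natChannels M j)) := by
      rw [h₂, ← hlisted]
      simp (disch := decide) [ha₁.nat, hrow]
    simp (disch := decide) [Program.effect, hanswer, State.answer, ha₁.nat, ha₁.real, hrow, hcol,
      hL.rowStart i hi.le]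
  · simp (disch := decide) [ha₁.nat]
    lia

theorem runs_fill (hL : Layout M σ) :
    Runs I.minPower .fill σ ((M + 3) ^ 2 * (σ.nat Reg.count 0 + 3) * 70)
      (Filled I σ.block) := by
  refine .mono (.forGrid (m := M) (T := (σ.nat Reg.count 0 + 3) * 60) (n := .users)
    (x := Reg.row) (y := Reg.col) (fun S τ => ∀ e ∈ S, e.2 < M →
      (1 ≤ τ.nat Reg.flag (e.1 * M + e.2) ↔
        (I.minPower e.1 (σ.block.natChannels M e.2)).isSome) ∧
      costs M τ e.1 e.2 = I.cost σ.block e.1 e.2) (by decide) (by decide) (by decide)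
    (fun σ' h => (h.layout hL).users) (fun _ _ _ h => ⟨h, h⟩) (by simp)
    fun i hi j hj S σ' ha hrow hcol h => ?_) ?_ fun τ _ h => ?_
  · rw [← ha.block_eq, ← congrFun (ha.nat Reg.count (by decide)) 0]
    refine (runs_fillEntry (ha.layout hL) hi hrow hcol).mono le_rfl fun τ _ hτ => ?_
    rintro ⟨k, l⟩ hkl hl
    by_cases hij : k = i ∧ l = j
    · obtain ⟨rfl, rfl⟩ := hij
      refine ⟨?_, by simp [costs, hτ, Instance.cost]⟩
      rw [hτ.1, Function.update_self]
      split_ifs with h' <;> simp [h']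
    · have hmem : (k, l) ∈ S := hkl.resolve_left (by simpa using hij)
      simpa [costs, hτ, Function.update_apply, entry_inj hl hj, hij, ha.block_eq] using
        h (k, l) hmem hl
  · rw [mul_assoc]
    exact Nat.mul_le_mul_left _ (by simp; lia)
  · refine ⟨?_, fun i hi j hj => (h (i, j) ⟨hi, hj⟩ hj).2⟩
    ext i j
    exact and_congr_right fun hi => and_congr_right fun hj => (h (i, j) ⟨hi, hj⟩ hj).1

theorem eval_assigned (hL : Layout M σ) {i : ℕ} (hrow : σ.nat Reg.row 0 = i) :
    NatExp.assigned.eval σ = stored M σ M i := by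
  simp [stored, hL.users, hL.rowStart M le_rfl, hrow]

theorem eval_assignedCost (hL : Layout M σ) {i : ℕ} (hi : i < M) (hrow : σ.nat Reg.row 0 = i) :
    RealExp.assignedCost.eval σ = costs M σ i (stored M σ M i) := by
  have h := eval_assigned hL hrow
  simp only [RealExp.eval, NatExp.eval] at h ⊢
  rw [h, hrow, hL.rowStart i hi.le, costs]

theorem runs_computeTotal (hM : 1 ≤ M) (hL : Layout M σ) {a : Allocation M} (ha : Proposes σ a)
    (hb : a.block.IsValid M N) :
    Runs O .computeTotal σ ((M + σ.nat Reg.count 0 + 6) * 50) fun τ =>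
      τ.real Reg.objective 0 = a.totalPower N := by
  refine .seq (T' := (σ.nat Reg.count 0 + 3) * 30) (.accumulate (m := M)
    (fun i => costs M σ i (stored M σ M i)) (fun σ' h => (h.layout hL).users)
    fun i hi σ' h hrow => ?_) (fun σ₁ ha₁ h₁ => .mono (.accumulate (m := σ.nat Reg.count 0)
      (fun _ => ∑ i, a.power i) (fun σ' h => ?_) fun _ _ σ' h _ => ?_) (by simp) fun τ _ h => ?_)
    (by simp; lia)
  · rw [eval_assignedCost (h.layout hL) hi hrow, h.costs_eq, h.stored_eq]
  · simp (disch := decide) [h.nat, ha₁.nat]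
  · have hpower : ∀ i : Fin M, a.power i = costs M σ i (stored M σ M i) := fun i => by
      rw [ha.power, ha.order]
    simp only [hpower, ← Finset.sum_range fun i => costs M σ i (stored M σ M i)]
    simp (disch := decide) [h.real, h₁]
  · rw [h, a.totalPower_eq hM hb, ha.block]
    simp

theorem runs_record (hL : Layout M σ) {a : Allocation M} (ha : Proposes σ a)
    (hobj : σ.real Reg.objective 0 = a.totalPower N) :
    Runs O .record σ ((M + 3) * 100) (State.Returns · a N) := by
  refine .mono (R := fun τ => (∀ i : Fin M, τ.nat Reg.order i = a.order i) ∧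
      (∀ i : Fin M, τ.real Reg.power i = a.power i) ∧ τ.nat Reg.output 0 = 1 ∧
      τ.nat Reg.output 1 = σ.nat Reg.count 0 ∧ τ.nat Reg.output 2 = σ.nat Reg.gap 0 ∧
      τ.nat Reg.output 3 = σ.nat Reg.offset 0 ∧
      τ.real Reg.total 0 = σ.real Reg.objective 0)
    (.seq (T' := (M + 3) * 50 + 60) (.sweep (m := M) (T := 12) (fun τ => τ.nat Reg.order)
      (stored M σ M) (by decide) (fun σ' h => (h.layout hL).users) (fun _ _ => rfl)
      fun i _ σ' h hrow _ => .of_effect rfl (by decide) ?_) (fun σ₁ ha₁ h₁ =>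
      .seq (T' := 50) (.sweep (m := M) (T := 20) (fun τ => τ.real Reg.power)
        (fun i => costs M σ i (stored M σ M i)) (by decide)
        (fun σ' h => (h.layout (ha₁.layout hL)).users) (fun _ _ => rfl)
        fun i hi σ' h hrow _ => .of_effect rfl (by decide) ?_) (fun σ₂ ha₂ h₂ =>
        .of_effect rfl (by decide) ⟨fun i => ?_, fun i => ?_, ?_⟩) (by simp; lia)) le_rfl)
    (by simp; lia) fun τ _ h => ?_
  · simp only [Program.effect, eval_assigned (h.layout hL) hrow, h.stored_eq]
    simp [hrow]
  · simp only [Program.effect, eval_assignedCost (h.layout (ha₁.layout hL)) hi hrow, h.stored_eq,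
      h.costs_eq, ha₁.stored_eq, ha₁.costs_eq]
    simp [hrow]
  · simp (disch := decide) [Program.effect, ha₂.nat, h₁, ha.order]
  · simp (disch := decide) [Program.effect, h₂, ha.power, ha.order]
  · simp (disch := decide) [Program.effect, ha₂.nat, ha₁.nat, ha₂.real, ha₁.real]
  · obtain ⟨horder, hpower, h0, h1, h2, h3, htotal⟩ := h
    rw [State.Returns, ha.block]
    exact ⟨h0, h1, h2, h3, horder, hpower, htotal.trans hobj⟩

end

end RAM

namespace IFDMA

variable {M N : ℕ}

/-- The blocks that precede `b` in the lexicographic order, in which the algorithm tries them. -/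
def Block.before (b : Block) : Set Block :=
  {b' | b'.c < b.c ∨ b'.c = b.c ∧ (b'.s < b.s ∨ b'.s = b.s ∧ b'.q < b.q)}

theorem Block.before_succ (c s q : ℕ) :
    (⟨c, s, q + 1⟩ : Block).before = insert ⟨c, s, q⟩ (⟨c, s, q⟩ : Block).before := by
  ext ⟨c', s', q'⟩
  simp only [before, Set.mem_ofPred_eq, Set.mem_insert_iff, Block.mk.injEq]
  lia

theorem Block.IsValid.of_le (hM : 1 ≤ M) {b b' : Block} (hb : b.IsValid M N) (h1 : 1 ≤ b'.c)
    (h0 : b'.c = 1 → b'.s = 0) (hc : b'.c ≤ b.c) (hs : b'.s ≤ b.s) (hq : b'.q ≤ b.q) :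
    b'.IsValid M N := by
  have hlength : b'.length M ≤ b.length M :=
    Nat.add_le_add_right (Nat.mul_le_mul (by lia) (by lia)) M
  exact (isValid_iff hM).2 ⟨h1, h0, by linarith [((isValid_iff hM).1 hb).2.2]⟩

theorem Block.IsValid.gap_le {b : Block} (hb : b.IsValid M N) : b.s ≤ N / (b.c - 1) := by
  obtain ⟨h1, -, h0, hs, -⟩ := hb
  obtain h | h := h1.eq_or_lt
  · simp [h0 h.symm]
  · exact (hs h).trans (Nat.div_le_div_right (Nat.sub_le _ _))

theorem Block.IsValid.mem_before_of_offset (hM : 1 ≤ M) {b : Block} {c s q : ℕ}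
    (hb : b.IsValid M N) (hlt : b ∈ (⟨c, s + 1, 0⟩ : Block).before)
    (hq : ¬ (⟨c, s, q⟩ : Block).IsValid M N) : b ∈ (⟨c, s, q⟩ : Block).before := by
  by_contra hge
  simp only [before, Set.mem_ofPred_eq] at hlt hge
  have hc : b.c = c := by lia
  have hs : b.s = s := by lia
  exact hq (hb.of_le hM (hc ▸ hb.1) (by simpa [hc, hs] using hb.2.2.1) hc.ge hs.ge (by lia))

theorem Block.IsValid.mem_before_of_gap (hM : 1 ≤ M) {b : Block} {c s : ℕ}
    (hb : b.IsValid M N) (hlt : b ∈ (⟨c + 1, 0, 0⟩ : Block).before)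
    (hs : ¬ (⟨c, s, 0⟩ : Block).IsValid M N) : b ∈ (⟨c, s, 0⟩ : Block).before := by
  by_contra hge
  simp only [before, Set.mem_ofPred_eq] at hlt hge
  have hc : b.c = c := by lia
  refine hs (hb.of_le hM (hc ▸ hb.1) (fun h => ?_) hc.ge (by simp; lia) (by simp))
  have hb0 := hb.2.2.1 (hc.trans h)
  lia

theorem Block.IsValid.mem_before_of_count (hM : 1 ≤ M) {b : Block} {c : ℕ} (h1 : 1 ≤ c)
    (hb : b.IsValid M N) (hc : ¬ (⟨c, 0, 0⟩ : Block).IsValid M N) :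
    b ∈ (⟨c, 0, 0⟩ : Block).before := by
  by_contra hge
  simp only [before, Set.mem_ofPred_eq] at hge
  exact hc (hb.of_le hM h1 (fun _ => rfl) (by simp; lia) (by simp) (by simp))

/-- `a` is feasible and at least as good as the feasible allocations with a block in `S`. -/
def Instance.IsOptimalOn (I : Instance M N) (S : Set Block) (a : Allocation M) : Prop :=
  I.IsFeasible a ∧
  ∀ a' : Allocation M, I.IsFeasible a' → a'.block ∈ S → a.totalPower N ≤ a'.totalPower N

end IFDMA

namespace RAM

open IFDMA

variable {M N : ℕ} {I : Instance M N} {S S' : Set Block} {σ τ : State} {P : Program}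

/-- The recorded result is correct as far as blocks in `S` are concerned. -/
def BestIn (I : Instance M N) (S : Set Block) (σ : State) : Prop :=
  (∃ a : Allocation M, I.IsOptimalOn S a ∧ σ.Returns a N) ∨
  ((∀ a : Allocation M, I.IsFeasible a → a.block ∉ S) ∧ σ.ReportsInfeasible)

theorem BestIn.mono (h : BestIn I S σ) (hS : ∀ a : Allocation M, I.IsFeasible a → a.block ∈ S' →
    a.block ∈ S) : BestIn I S' σ :=
  h.imp (fun ⟨a, ha, hret⟩ => ⟨a, ⟨ha.1, fun a' h' hb => ha.2 a' h' (hS a' h' hb)⟩, hret⟩)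
    fun ⟨hno, hrep⟩ => ⟨fun a ha hb => hno a ha (hS a ha hb), hrep⟩

theorem Agree.bestIn (h : Agree P σ τ) (hS : BestIn I S σ)
    (hn : ∀ a ∈ [Reg.output, Reg.order], a ∉ P.natTargets := by decide)
    (hr : ∀ a ∈ [Reg.power, Reg.total], a ∉ P.realTargets := by decide) : BestIn I S τ := by
  simpa only [BestIn, State.Returns, State.ReportsInfeasible, h.nat _ (hn Reg.output (by decide)),
    h.nat _ (hn Reg.order (by decide)), h.real _ (hr Reg.power (by decide)),
    h.real _ (hr Reg.total (by decide))] using hS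

theorem exists_proposes (hM : 1 ≤ M) (hI : I.HasMinima) (hb : σ.block.IsValid M N)
    (hF : Filled I σ.block σ) (h : Matched M M σ) :
    ∃ a : Allocation M, Proposes σ a ∧ I.IsOptimalOn {σ.block} a := by
  have hmatch : Hungarian.IsMatching (I.Fits σ.block) (Set.Iio M) (stored M σ M) :=
    h.matching.mono subset_rfl fun i _ hi => hF.entries_eq ▸ hi.1
  obtain ⟨a, ha, hab, horder, hpower⟩ := I.exists_allocation_of_isMatching hb hmatch
  refine ⟨a, ⟨hab, horder, fun i => ?_⟩, ha, fun a' ha' hb' => ?_⟩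
  · rw [hpower, horder, hF.costs_eq i i.2 _ (hmatch.edge i i.2).2.1]
  · obtain ⟨ν, hν, hle⟩ := ha'.exists_isMatching hM hI
    rw [Set.mem_singleton_iff.1 hb'] at hν hle
    have hcosts : ∀ ρ, Hungarian.IsMatching (I.Fits σ.block) (Set.Iio M) ρ →
        ∑ i ∈ Finset.range M, costs M σ i (ρ i) = ∑ i ∈ Finset.range M, I.cost σ.block i (ρ i) :=
      fun ρ hρ => Finset.sum_congr rfl fun i hi =>
        hF.costs_eq i (Finset.mem_range.1 hi) _ (hρ.edge i (Finset.mem_range.1 hi)).2.1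
    have hsum := Hungarian.IsMatching.sum_le (S := .range M) (T := .range M)
      (by simpa using! h.matching) h.dual (by simpa [hF.entries_eq] using! hν)
      (fun i j hij => Finset.mem_range.2 hij.2.1) le_rfl
    rw [hcosts _ hmatch, hcosts _ hν] at hsum
    rw [a.totalPower_eq hM ha.1, hab, Finset.sum_congr rfl fun i _ => hpower i,
      ← Finset.sum_range fun i => I.cost σ.block i (stored M σ M i)]
    exact (mul_le_mul_of_nonneg_left hsum (Nat.cast_nonneg _)).trans hle

theorem runs_accept {O : ℕ → Finset ℕ → Option ℝ} (hL : Layout M σ) {a : Allocation M}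
    (ha : Proposes σ a) (hobj : σ.real Reg.objective 0 = a.totalPower N)
    (hopt : I.IsOptimalOn {σ.block} a) (hS : BestIn I S σ) :
    Runs O .accept σ ((M + 3) * 110) (BestIn I (insert σ.block S)) := by
  refine .mono (.branch (T := (M + 3) * 100)
    (fun hb => .of_effect rfl (by simp [Program.steps]; lia) ?_)
    fun hb => (runs_record hL ha hobj).mono le_rfl fun τ _ hτ =>
      .inl ⟨a, ⟨hopt.1, fun a' ha' hb' => ?_⟩, hτ⟩) (by simp; lia) fun _ _ h => h
  · obtain ⟨a₀, ha₀, hret⟩ | ⟨-, hrep⟩ := hS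
    · refine .inl ⟨a₀, ⟨ha₀.1, fun a' ha' hb' => hb'.elim (fun hb' => ?_) (ha₀.2 a' ha')⟩, hret⟩
      calc a₀.totalPower N = σ.real Reg.total 0 := hret.2.2.2.2.2.2.symm
        _ ≤ a.totalPower N := hb.2.trans_eq hobj
        _ ≤ a'.totalPower N := hopt.2 a' ha' hb'
    · exact absurd (hb.1.trans_eq hrep) (by simp)
  · refine hb'.elim (hopt.2 a' ha') fun hb' => ?_
    obtain ⟨a₀, ha₀, hret⟩ | ⟨hno, -⟩ := hS
    · have hlt : ¬ σ.real Reg.total 0 ≤ σ.real Reg.objective 0 := fun h => hb ⟨hret.1.ge, h⟩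
      calc a.totalPower N = σ.real Reg.objective 0 := hobj.symm
        _ ≤ σ.real Reg.total 0 := (not_le.1 hlt).le
        _ = a₀.totalPower N := hret.2.2.2.2.2.2
        _ ≤ a'.totalPower N := ha₀.2 a' ha' hb'
    · exact absurd hb' (hno a' ha')

theorem runs_compare {O : ℕ → Finset ℕ → Option ℝ} (hI : I.HasMinima) (hM : 1 ≤ M)
    (hL : Layout M σ) (hb : σ.block.IsValid M N) (hF : Filled I σ.block σ) (h : Assigned M M σ)
    (hS : BestIn I S σ) :
    Runs O .compare σ ((M + 3 + (σ.nat Reg.count 0 + 3)) * 200)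
      (BestIn I (insert σ.block S)) := by
  refine .mono (.branch (T := (M + 3 + (σ.nat Reg.count 0 + 3)) * 190) (fun hf => ?_) fun hf =>
    .of_effect rfl (by simp [Program.steps]; lia) (hS.mono fun a ha hab => ?_)) (by simp; lia)
    fun _ _ h => h
  · obtain ⟨-, hmatched⟩ | ⟨hf', -⟩ := h
    · obtain ⟨a, ha, hopt⟩ := exists_proposes hM hI hb hF hmatched
      refine (runs_computeTotal hM hL ha hopt.1.1).seq (T' := (M + 3) * 110)
        (fun σ' ha' hobj => ?_) (by lia)
      rw [← ha'.block_eq] at hopt ⊢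
      exact runs_accept (ha'.layout hL) ⟨ha.block.trans ha'.block_eq.symm,
        by simpa only [ha'.stored_eq] using ha.order, by simpa only [ha'.costs_eq] using ha.power⟩
        hobj hopt (ha'.bestIn hS)
    · simp [hf'] at hf
  · refine hab.resolve_left fun hab => ?_
    obtain ⟨hf', -⟩ | ⟨-, hno⟩ := h
    · simp [hf'] at hf
    · obtain ⟨ν, hν, -⟩ := ha.exists_isMatching hM hI
      exact hno ν (by rwa [hF.entries_eq, ← hab])

theorem runs_tryBlock (hI : I.HasMinima) (hM : 1 ≤ M) (hL : Layout M σ)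
    (hb : σ.block.IsValid M N) (hS : BestIn I S σ) :
    Runs I.minPower .tryBlock σ
      ((M + 3) ^ 2 * ((M + 3) ^ 2 + (σ.nat Reg.count 0 + 3)) * 1000)
      (BestIn I (insert σ.block S)) := by
  refine (runs_fill hL).seq (fun σ₁ ha₁ h₁ => .seq (runs_assign (ha₁.layout hL)
    fun i j hij => ?_) (fun σ₂ ha₂ h₂ => ?_) le_rfl) ?_
    (T' := (M + 3) ^ 4 * 600 + (M + 3 + (σ.nat Reg.count 0 + 3)) * 200 + 1)
  · rw [h₁.costs_eq i hij.1 j hij.2.1]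
    rw [h₁.entries_eq] at hij
    exact hij.cost_nonneg
  · have hblock : σ₂.block = σ.block := ha₂.block_eq.trans ha₁.block_eq
    have hF : Filled I σ₂.block σ₂ := hblock ▸
      ⟨ha₂.entries_eq.trans h₁.entries_eq, fun i hi j hj => ha₂.costs_eq ▸ h₁.costs_eq i hi j hj⟩
    have hcount : σ₂.nat Reg.count 0 = σ.nat Reg.count 0 := congrArg Block.c hblock
    rw [← hblock] at hb ⊢
    rw [← hcount]
    exact runs_compare hI hM (ha₂.layout (ha₁.layout hL)) hb hF h₂ (ha₂.bestIn (ha₁.bestIn hS))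
  · generalize σ.nat Reg.count 0 + 3 = c
    calc _ ≤ (M + 3) ^ 4 * 1000 + (M + 3) ^ 2 * c * 1000 := by lia
      _ = _ := by ring

theorem runs_tryOffset (hI : I.HasMinima) (hM : 1 ≤ M) (hL : Layout M σ)
    (hb : σ.block.IsValid M N) (hS : BestIn I σ.block.before σ) :
    Runs I.minPower .tryOffset σ
      ((M + 3) ^ 2 * ((M + 3) ^ 2 + (σ.nat Reg.count 0 + 3)) * 1000 + 7)
      fun τ => BestIn I τ.block.before τ ∧ τ.nat Reg.offset 0 = σ.nat Reg.offset 0 + 1 := by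
  refine (runs_tryBlock hI hM hL hb hS).seq (fun σ₁ ha₁ h₁ => (runs_effect σ₁ rfl).mono le_rfl
    fun τ ha h => ?_) (by simp [Program.steps])
  have hoffset : τ.nat Reg.offset 0 = σ.nat Reg.offset 0 + 1 := by
    simp (disch := decide) [h, Program.effect, ha₁.nat]
  have hblock : τ.block = ⟨σ.nat Reg.count 0, σ.nat Reg.gap 0, σ.nat Reg.offset 0 + 1⟩ := by
    simp (disch := decide) [State.block, hoffset, ha.nat, ha₁.nat]
  rw [hblock, Block.before_succ]
  exact ⟨ha.bestIn h₁, hoffset⟩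

theorem gaps_mul_time_le {c A : ℕ} (hc : c ≤ N) (hA : 8 ≤ A) :
    (N / (c - 1) + 3) * ((N + 3) * (A * (A + (c + 3)))) ≤ (N + 3) ^ 2 * A ^ 2 * 2 := by
  have hgaps : N / (c - 1) + 3 ≤ N + 3 := Nat.add_le_add_right (Nat.div_le_self N (c - 1)) 3
  have hchannels : (N / (c - 1) + 3) * (c + 3) ≤ (N + 3) * 8 := by
    obtain h | h := Nat.eq_zero_or_pos (c - 1)
    · simp only [h, Nat.div_zero]
      lia
    · have hdiv := Nat.div_mul_le_self N (c - 1)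
      obtain ⟨d, rfl⟩ : ∃ d, c = d + 1 := ⟨c - 1, by lia⟩
      rw [Nat.add_sub_cancel] at hdiv hgaps ⊢
      linarith
  calc (N / (c - 1) + 3) * ((N + 3) * (A * (A + (c + 3))))
      = (N + 3) * A * ((N / (c - 1) + 3) * A + (N / (c - 1) + 3) * (c + 3)) := by ring
    _ ≤ (N + 3) * A * ((N + 3) * A + (N + 3) * A) :=
      Nat.mul_le_mul_left _ (Nat.add_le_add (Nat.mul_le_mul_right _ hgaps)
        (hchannels.trans (Nat.mul_le_mul_left _ hA)))
    _ = (N + 3) ^ 2 * A ^ 2 * 2 := by ring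

section Loops

variable {c s : ℕ} (hI : I.HasMinima) (hM : 1 ≤ M) (hL : Layout M σ)
  (hN : σ.nat Reg.input 1 = N)
include hI hM hL hN

theorem runs_loop_tryOffset (hcount : σ.nat Reg.count 0 = c) (hgap : σ.nat Reg.gap 0 = s)
    (hlength : σ.nat Reg.length 0 = Block.length ⟨c, s, 0⟩ M) (hoffset : σ.nat Reg.offset 0 = 0)
    (hb : (⟨c, s, 0⟩ : Block).IsValid M N) (hS : BestIn I (⟨c, s, 0⟩ : Block).before σ) :
    Runs I.minPower (.loop .fitsAtOffset .tryOffset) σ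
      ((N + 3) * ((M + 3) ^ 2 * ((M + 3) ^ 2 + (c + 3)) * 1000 + 20))
      (BestIn I (⟨c, s + 1, 0⟩ : Block).before) := by
  have hblock : ∀ {τ}, Agree .tryOffset σ τ → τ.block = ⟨c, s, τ.nat Reg.offset 0⟩ := fun ha => by
    simp (disch := decide) [ha.nat, hcount, hgap]
  have hvalid : ∀ {τ}, Agree .tryOffset σ τ →
      (τ.block.IsValid M N ↔ Test.fitsAtOffset.Holds τ) := fun ha => by
    rw [hblock ha, Block.isValid_iff hM]
    simpa (disch := decide) [ha.nat, hN, hlength, Block.length, hb.1] using fun _ => hb.2.2.1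
  refine .mono (Runs.loop (T := (M + 3) ^ 2 * ((M + 3) ^ 2 + (c + 3)) * 1000 + 7)
    (fun τ => BestIn I τ.block.before τ) (fun τ => N + 1 - τ.nat Reg.offset 0) ?_
    fun τ ha hS ht => ?_) (by simp [hoffset]) fun τ ha hτ => hτ.1.mono fun a ha' hlt => ?_
  · simpa [hblock (.refl _ _), hoffset] using hS
  · have hv := (hvalid ha).2 ht
    have hq : τ.nat Reg.offset 0 ≤ N := hv.2.2.2.2.trans (Nat.sub_le _ _)
    refine (runs_tryOffset hI hM (ha.layout hL) hv hS).mono ?_ fun τ' _ hτ' =>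
      ⟨hτ'.1, fun _ => by lia⟩
    rw [ha.nat _ (by decide), hcount]
  · replace ha : Agree .tryOffset σ τ := ⟨ha.nat, ha.real⟩
    rw [hblock ha]
    exact ha'.1.mem_before_of_offset hM hlt (hblock ha ▸ (hvalid ha).not.2 hτ.2)

theorem runs_tryOffsets (hcount : σ.nat Reg.count 0 = c) (hgap : σ.nat Reg.gap 0 = s)
    (hlength : σ.nat Reg.length 0 = Block.length ⟨c, s, 0⟩ M)
    (hb : (⟨c, s, 0⟩ : Block).IsValid M N) (hS : BestIn I (⟨c, s, 0⟩ : Block).before σ) :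
    Runs I.minPower .tryOffsets σ ((N + 3) * ((M + 3) ^ 2 * ((M + 3) ^ 2 + (c + 3))) * 1100)
      (BestIn I (⟨c, s + 1, 0⟩ : Block).before) := by
  refine (runs_effect σ rfl).seq (fun σ₁ ha₁ h₁ => runs_loop_tryOffset hI hM (ha₁.layout hL)
    ?_ ?_ ?_ ?_ ?_ hb (ha₁.bestIn hS)) ?_
  · rw [ha₁.nat _ (by decide), hN]
  · rw [ha₁.nat _ (by decide), hcount]
  · rw [ha₁.nat _ (by decide), hgap]
  · rw [ha₁.nat _ (by decide), hlength]
  · simp [h₁, Program.effect]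
  · simp [Program.steps]
    ring_nf
    lia

theorem runs_tryGap (hcount : σ.nat Reg.count 0 = c) (hgap : σ.nat Reg.gap 0 = s)
    (hlength : σ.nat Reg.length 0 = Block.length ⟨c, s, 0⟩ M)
    (hb : (⟨c, s, 0⟩ : Block).IsValid M N) (hS : BestIn I (⟨c, s, 0⟩ : Block).before σ) :
    Runs I.minPower .tryGap σ ((N + 3) * ((M + 3) ^ 2 * ((M + 3) ^ 2 + (c + 3))) * 1110)
      fun τ => BestIn I (⟨c, s + 1, 0⟩ : Block).before τ ∧ τ.nat Reg.gap 0 = s + 1 ∧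
        τ.nat Reg.length 0 = Block.length ⟨c, s + 1, 0⟩ M := by
  refine (runs_tryOffsets hI hM hL hN hcount hgap hlength hb hS).seq (fun σ₁ ha₁ h₁ =>
    (runs_effect σ₁ rfl).mono le_rfl fun τ ha h => ⟨ha.bestIn h₁, ?_, ?_⟩) ?_
  · simp (disch := decide) [h, Program.effect, ha₁.nat, hgap]
  · simp (disch := decide) [h, Program.effect, ha₁.nat, hlength, hcount, Block.length]
    ring
  · simp [Program.steps]
    ring_nf
    lia

theorem runs_loop_tryGap (hcount : σ.nat Reg.count 0 = c) (hgap : σ.nat Reg.gap 0 = 0)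
    (hlength : σ.nat Reg.length 0 = Block.length ⟨c, 0, 0⟩ M) (hc : 1 ≤ c)
    (hS : BestIn I (⟨c, 0, 0⟩ : Block).before σ) :
    Runs I.minPower (.loop .hasBlock .tryGap) σ
      ((N / (c - 1) + 3) * ((N + 3) * ((M + 3) ^ 2 * ((M + 3) ^ 2 + (c + 3))) * 1200))
      (BestIn I (⟨c + 1, 0, 0⟩ : Block).before) := by
  have hvalid : ∀ {τ}, Agree .tryGap σ τ →
      τ.nat Reg.length 0 = Block.length ⟨c, τ.nat Reg.gap 0, 0⟩ M →
      ((⟨c, τ.nat Reg.gap 0, 0⟩ : Block).IsValid M N ↔ Test.hasBlock.Holds τ) :=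
    fun ha hlength => by
      simp (disch := decide) [Block.isValid_iff hM, ha.nat, hN, hcount, hlength]
      lia
  refine .mono (Runs.loop (T := (N + 3) * ((M + 3) ^ 2 * ((M + 3) ^ 2 + (c + 3))) * 1110)
    (fun τ => BestIn I (⟨c, τ.nat Reg.gap 0, 0⟩ : Block).before τ ∧
      τ.nat Reg.length 0 = Block.length ⟨c, τ.nat Reg.gap 0, 0⟩ M)
    (fun τ => N / (c - 1) + 1 - τ.nat Reg.gap 0) ⟨?_, ?_⟩ fun τ ha hS ht => ?_) ?_
    fun τ ha hτ => hτ.1.1.mono fun a ha' hlt => ?_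
  · rwa [hgap]
  · rwa [hgap]
  · have hv := (hvalid ha hS.2).2 ht
    refine (runs_tryGap hI hM (ha.layout hL) ?_ ?_ rfl hS.2 hv hS.1).mono le_rfl
      fun τ' _ ⟨hbest, hgap', hlength'⟩ => ⟨hgap'.symm ▸ ⟨hbest, hlength'⟩, fun _ => ?_⟩
    · rw [ha.nat _ (by decide), hN]
    · rw [ha.nat _ (by decide), hcount]
    · have hle := hv.gap_le
      simp only at hle
      lia
  · rw [hgap]
    refine Nat.mul_le_mul_left _ ?_
    simp
    ring_nf
    lia
  · replace ha : Agree .tryGap σ τ := ⟨ha.nat, ha.real⟩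
    exact ha'.1.mem_before_of_gap hM hlt ((hvalid ha hτ.1.2).not.2 hτ.2)

theorem runs_tryGaps (hcount : σ.nat Reg.count 0 = c) (hbase : σ.nat Reg.base 0 = c * M)
    (hb : (⟨c, 0, 0⟩ : Block).IsValid M N) (hS : BestIn I (⟨c, 0, 0⟩ : Block).before σ) :
    Runs I.minPower .tryGaps σ ((N + 3) ^ 2 * (M + 3) ^ 4 * 3000)
      (BestIn I (⟨c + 1, 0, 0⟩ : Block).before) := by
  have htime := gaps_mul_time_le (c := c) (hb.2.1.trans (Nat.div_le_self _ _))
    (show 8 ≤ (M + 3) ^ 2 by nlinarith)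
  refine (runs_effect σ rfl).seq (fun σ₁ ha₁ h₁ => (runs_effect σ₁ rfl).seq (fun σ₂ ha₂ h₂ =>
    runs_loop_tryGap hI hM (ha₂.layout (ha₁.layout hL)) ?_ ?_ ?_ ?_ hb.1
      (ha₂.bestIn (ha₁.bestIn hS))) le_rfl) ?_
  · rw [ha₂.nat _ (by decide), ha₁.nat _ (by decide), hN]
  · rw [ha₂.nat _ (by decide), ha₁.nat _ (by decide), hcount]
  · simp [h₂, h₁, Program.effect]
  · calc σ₂.nat Reg.length 0 = c * M := by simp [h₂, h₁, Program.effect, hbase]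
      _ = (c - 1 + 1) * M := by rw [Nat.sub_add_cancel hb.1]
      _ = Block.length ⟨c, 0, 0⟩ M := Nat.succ_mul _ _
  · simp [Program.steps]
    lia

theorem runs_tryCount (hcount : σ.nat Reg.count 0 = c) (hbase : σ.nat Reg.base 0 = c * M)
    (hb : (⟨c, 0, 0⟩ : Block).IsValid M N) (hS : BestIn I (⟨c, 0, 0⟩ : Block).before σ) :
    Runs I.minPower .tryCount σ ((N + 3) ^ 2 * (M + 3) ^ 4 * 3010)
      fun τ => BestIn I (⟨c + 1, 0, 0⟩ : Block).before τ ∧ τ.nat Reg.count 0 = c + 1 ∧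
        τ.nat Reg.base 0 = (c + 1) * M := by
  refine (runs_tryGaps hI hM hL hN hcount hbase hb hS).seq (fun σ₁ ha₁ h₁ =>
    (runs_effect σ₁ rfl).mono le_rfl fun τ ha h => ⟨ha.bestIn h₁, ?_, ?_⟩) ?_
  · simp (disch := decide) [h, Program.effect, ha₁.nat, hcount]
  · simp (disch := decide) [h, Program.effect, ha₁.nat, hbase, hL.users]
    ring
  · have hpos : 1 ≤ (N + 3) ^ 2 * (M + 3) ^ 4 := Nat.one_le_iff_ne_zero.2 (by positivity)
    simp [Program.steps]
    lia

theorem runs_loop_tryCount (hcount : σ.nat Reg.count 0 = 1) (hbase : σ.nat Reg.base 0 = M)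
    (hS : BestIn I (⟨1, 0, 0⟩ : Block).before σ) :
    Runs I.minPower (.loop (.natLe (.get Reg.base) .channels) .tryCount) σ
      ((N / M + 3) * ((N + 3) ^ 2 * (M + 3) ^ 4 * 3100)) (BestIn I Set.univ) := by
  refine .mono (Runs.loop (T := (N + 3) ^ 2 * (M + 3) ^ 4 * 3010)
    (fun τ => BestIn I (⟨τ.nat Reg.count 0, 0, 0⟩ : Block).before τ ∧ 1 ≤ τ.nat Reg.count 0 ∧
      τ.nat Reg.base 0 = τ.nat Reg.count 0 * M)
    (fun τ => N / M + 1 - τ.nat Reg.count 0) ⟨?_, ?_, ?_⟩ fun τ ha ⟨hS, hc, hbase⟩ ht => ?_) ?_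
    fun τ ha hτ => hτ.1.1.mono fun a ha' _ => ?_
  · rwa [hcount]
  · rw [hcount]
  · rw [hbase, hcount, one_mul]
  · have hle : τ.nat Reg.count 0 ≤ N / M := (Nat.le_div_iff_mul_le hM).2 <| by
      simpa (disch := decide) [hbase, ha.nat, hN] using ht
    have hv : (⟨τ.nat Reg.count 0, 0, 0⟩ : Block).IsValid M N :=
      ⟨hc, hle, fun _ => rfl, fun _ => Nat.zero_le _, Nat.zero_le _⟩
    refine (runs_tryCount hI hM (ha.layout hL) ?_ rfl hbase hv hS).mono le_rfl
      fun τ' _ ⟨hbest, hcount', hbase'⟩ => ⟨hcount'.symm ▸ ⟨hbest, by lia, hbase'⟩, fun _ => by lia⟩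
    rw [ha.nat _ (by decide), hN]
  · rw [hcount]
    refine Nat.mul_le_mul (by lia) ?_
    simp
    lia
  · have hnot : ¬ (⟨τ.nat Reg.count 0, 0, 0⟩ : Block).IsValid M N := fun hv => hτ.2 <| by
      simpa (disch := decide) [hτ.1.2.2, ha.nat, hN] using (Nat.le_div_iff_mul_le hM).1 hv.2.1
    exact ha'.1.mem_before_of_count hM hτ.1.2.1 hnot

theorem runs_tryCounts (hMN : M ≤ N) (hS : BestIn I (⟨1, 0, 0⟩ : Block).before σ) :
    Runs I.minPower .tryCounts σ ((M + 3) ^ 3 * (N + 3) ^ 3 * 22000) (BestIn I Set.univ) := by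
  have htime : (N / M + 3) * (M + 3) ≤ (N + 3) * 7 := by
    linarith [Nat.div_mul_le_self N M, Nat.div_le_self N M]
  refine (runs_effect σ rfl).seq (fun σ₁ ha₁ h₁ => (runs_effect σ₁ rfl).seq (fun σ₂ ha₂ h₂ =>
    runs_loop_tryCount hI hM (ha₂.layout (ha₁.layout hL)) ?_ ?_ ?_
      (ha₂.bestIn (ha₁.bestIn hS))) le_rfl) ?_
  · rw [ha₂.nat _ (by decide), ha₁.nat _ (by decide), hN]
  · simp [h₂, h₁, Program.effect]
  · simp [h₂, h₁, Program.effect, hL.users]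
  · have hloop := Nat.mul_le_mul_right ((N + 3) ^ 2 * (M + 3) ^ 3 * 3100) htime
    simp [Program.steps]
    lia

end Loops

theorem runs_minPower (hI : I.HasMinima) (hM : 1 ≤ M) (hMN : M ≤ N) :
    Runs I.minPower .minPower (.init M N) ((4 * M) ^ 3 * (4 * N) ^ 3 * 23000)
      (BestIn I Set.univ) := by
  have husers : (State.init M N).nat Reg.input 0 = M := by simp [State.init]
  have hchannels : (State.init M N).nat Reg.input 1 = N := by simp [State.init]
  refine .mono (.seq (.progression (m := M) M (by decide) (fun σ' h => ?_) fun σ' h => ?_)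
    (fun σ ha hσ => runs_tryCounts hI hM ⟨?_, fun l hl => ?_⟩ ?_ hMN
      (.inr ⟨fun a ha' hlt => ?_, ?_⟩)) le_rfl) ?_ fun _ _ h => h
  · simpa [h.nat Reg.input (by decide)] using husers
  · simpa [h.nat Reg.input (by decide)] using husers
  · rw [ha.nat _ (by decide), husers]
  · simpa using hσ l hl
  · rw [ha.nat _ (by decide), hchannels]
  · have hc := ha'.1.1
    simp only [Block.before, Set.mem_ofPred_eq] at hlt
    lia
  · rw [State.ReportsInfeasible, ha.nat 1 (by decide)]
    simp [State.init]
  · have hpow : (M + 3) ^ 3 * (N + 3) ^ 3 ≤ (4 * M) ^ 3 * (4 * N) ^ 3 := by gcongr <;> lia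
    simp
    lia

end RAM

theorem theorem1 :
    (∀ M N : ℕ, 1 ≤ M → M ≤ N →
      {b : IFDMA.Block | b.IsValid M N}.encard ≤ (((N + 1) + (N + 1) ^ 3 : ℕ) : ℕ∞)) ∧
    ∃ (P : RAM.Program) (C : ℕ), ∀ (M N : ℕ), 1 ≤ M → M ≤ N →
      ∀ I : IFDMA.Instance M N, I.HasMinima →
        ∃ (σ : RAM.State) (t : ℕ),
          RAM.Exec I.minPower P (RAM.State.init M N) σ t ∧
          t ≤ C * (M ^ 3 * N ^ 3) ∧
          ((∃ a : IFDMA.Allocation M, I.IsOptimal a ∧ σ.Returns a N) ∨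
            ((∀ a : IFDMA.Allocation M, ¬ I.IsFeasible a) ∧ σ.ReportsInfeasible)) := by
  refine ⟨fun M N hM _ => IFDMA.Block.encard_isValid_le hM, .minPower, 4 ^ 6 * 23000,
    fun M N hM hMN I hI => ?_⟩
  obtain ⟨σ, t, hexec, htime, hbest⟩ := RAM.runs_minPower hI hM hMN
  refine ⟨σ, t, hexec, htime.trans_eq (by ring), ?_⟩
  obtain ⟨a, ha, hret⟩ | ⟨hno, hrep⟩ := hbest
  · exact .inl ⟨a, ⟨ha.1, fun a' ha' => ha.2 a' ha' trivial⟩, hret⟩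
  · exact .inr ⟨fun a ha => hno a ha trivial, hrep⟩
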